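/- Let $G$ be a group with a finite generating set $S$, let $\ell_S(g)$ denote the distance from $g$ to $1$ in the Cayley graph of $G$ with respect to $S$, and let $\psi$ be an automorphism of $G$. The (multiplicative) entropy of $\psi$ with respect to $S$ is $$K_{\psi,S}=\max_{s\in S}\ \limsup_{n\to\infty}\ \ell_S(\psi^n(s))^{1/n},$$ with the convention $\max\emptyset = 0$; by submultiplicativity it equals the genuine limit $\lim_{n\to\infty}\bigl(\max_{s\in S}\ell_S(\psi^n(s))\bigr)^{1/n}$. Theorem. Let $N$ be a finitely generated torsion-free nilpotent group, let $\phi$ be an automorphism of $N$, and let $\overline{\phi}$ be the induced automorphism of $H_1(N,\mathbb{Z})=N/[N,N]$. Then $K_{\phi}=K_{\overline{\phi}}$; that is, for every finite generating set $S$ of $N$ and every finite generating set $T$ of $H_1(N,\mathbb{Z})$, $$K_{\phi,S}=K_{\overline{\phi},T}.$$ Moreover, this number is the spectral radius of the $\mathbb{C}$-linear map $\mathrm{id}\otimes\overline{\phi}$ on $H_1(N,\mathbb{Z})\otimes_{\mathbb{Z}}\mathbb{C}$ (the spectral radius on the zero space being $0$). -/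

import Mathlib

open Filter Topology
open scoped ENNReal TensorProduct

namespace WordEntropy

/-- The word length of `g` with respect to `S`: the distance from `g` to `1` in the Cayley graph of
the group with respect to `S`. -/
noncomputable def wordLength {G : Type*} [Group G] (S : Set G) (g : G) : ℕ :=
  (SimpleGraph.mulCayley S).dist g 1

/-- The exponential growth rate `limsup ℓ(φⁿ(g))^(1/n)` of an element `g` under iteration of `φ`. -/
noncomputable def growthRate {G : Type*} [Group G] (S : Set G) (φ : MulAut G) (g : G) : ℝ≥0∞ :=
  limsup (fun n : ℕ => (wordLength S ((φ ^ n) g) : ℝ≥0∞) ^ ((n : ℝ)⁻¹)) atTop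

/-- The (multiplicative) entropy of `φ` with respect to a finite generating set `S`: the largest
growth rate of a generator. By `tendsto_entropy` it is the limit of the `n`-th roots of the largest
length of an image `φⁿ(s)`, and by `entropy_eq_of_tendsto` it is the largest of the limits of
`ℓ(φⁿ(s))^(1/n)` if these exist. -/
noncomputable def entropy {G : Type*} [Group G] (S : Finset G) (φ : MulAut G) : ℝ≥0∞ :=
  S.sup fun s => growthRate (S : Set G) φ s

/-- The automorphism of the abelianization `H₁(G, ℤ)` of `G` that is induced by `φ`. -/
def inducedAut {G : Type*} [Group G] (φ : MulAut G) : MulAut (Abelianization G) :=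
  MulEquiv.abelianizationCongr φ

/-- The `ℂ`-linear endomorphism of `H₁(G, ℂ) = ℂ ⊗ H₁(G, ℤ)` that is induced by `φ`. -/
noncomputable def homologyMap {G : Type*} [Group G] (φ : MulAut G) :
    Module.End ℂ (ℂ ⊗[ℤ] Additive (Abelianization G)) :=
  LinearMap.baseChange ℂ
    (MonoidHom.toAdditive (inducedAut φ : MulAut (Abelianization G)).toMonoidHom).toIntLinearMap

theorem exists_walk {G : Type*} [Group G] {S : Set G} (w : List G)
    (hw : ∀ x ∈ w, x ∈ S ∨ x⁻¹ ∈ S) (u : G) :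
    ∃ p : (SimpleGraph.mulCayley S).Walk (u * w.prod) u, p.length ≤ w.length := by
  induction w generalizing u with
  | nil =>
    exact ⟨SimpleGraph.Walk.nil.copy (by simp) rfl, by rw [SimpleGraph.Walk.length_copy]; simp⟩
  | cons a v ih =>
    obtain ⟨p, hp⟩ := ih (fun x hx => hw x (by simp [hx])) (u * a)
    by_cases ha : a = 1
    · exact ⟨p.copy (by simp [mul_assoc]) (by simp [ha]), by simp; omega⟩
    · have hadj : (SimpleGraph.mulCayley S).Adj (u * a) u := by
        rw [SimpleGraph.mulCayley_adj']
        refine ⟨by simpa using ha, ?_⟩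
        rcases hw a (by simp) with h | h
        · exact ⟨a, h, Or.inr rfl⟩
        · exact ⟨a⁻¹, h, Or.inl (by simp)⟩
      exact ⟨(p.concat hadj).copy (by simp [mul_assoc]) rfl, by simpa using hp⟩

theorem exists_word_of_walk {G : Type*} [Group G] {S : Set G} {g h : G}
    (p : (SimpleGraph.mulCayley S).Walk g h) :
    ∃ w : List G, (∀ x ∈ w, x ∈ S ∨ x⁻¹ ∈ S) ∧ h * w.prod = g ∧ w.length = p.length := by
  induction p with
  | nil => exact ⟨[], by simp, by simp, rfl⟩
  | @cons u v t hadj p ih =>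
    obtain ⟨w, hw, hg, hl⟩ := ih
    have key : ∀ x : G, (x ∈ S ∨ x⁻¹ ∈ S) → v * x = u →
        ∃ w : List G, (∀ x ∈ w, x ∈ S ∨ x⁻¹ ∈ S) ∧ t * w.prod = u ∧
          w.length = (SimpleGraph.Walk.cons hadj p).length := by
      intro x hx hu
      refine ⟨w ++ [x], fun y hy => ?_, by simp [← mul_assoc, hg, hu], by simp [hl]⟩
      rcases List.mem_append.1 hy with h | h
      · exact hw y h
      · rw [List.mem_singleton.1 h]
        exact hx
    rw [SimpleGraph.mulCayley_adj'] at hadj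
    obtain ⟨-, a, ha, h | h⟩ := hadj
    · exact key a⁻¹ (by simp [ha]) (by simp [← h])
    · exact key a (Or.inl ha) h.symm

theorem wordLength_le {G : Type*} [Group G] {S : Set G} (w : List G)
    (hw : ∀ x ∈ w, x ∈ S ∨ x⁻¹ ∈ S) : wordLength S w.prod ≤ w.length := by
  obtain ⟨p, hp⟩ := exists_walk w hw 1
  exact (SimpleGraph.dist_le (p.copy (one_mul _) rfl)).trans (by simpa using hp)

/-- For a generating set, the word length of `g` is attained by a word that represents `g`. -/
theorem exists_word {G : Type*} [Group G] {S : Set G} (hS : Subgroup.closure S = ⊤) (g : G) :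
    ∃ w : List G, (∀ x ∈ w, x ∈ S ∨ x⁻¹ ∈ S) ∧ w.prod = g ∧ w.length = wordLength S g := by
  have hg : g ∈ Submonoid.closure (S ∪ S⁻¹) := by
    rw [← Subgroup.closure_toSubmonoid, hS]
    trivial
  obtain ⟨w, hw, rfl⟩ := Submonoid.exists_list_of_mem_closure hg
  obtain ⟨p, -⟩ := exists_walk (S := S) w (fun x hx => by simpa using hw x hx) 1
  have hr : (SimpleGraph.mulCayley S).Reachable w.prod 1 := ⟨p.copy (one_mul _) rfl⟩
  obtain ⟨q, hq⟩ := hr.exists_walk_length_eq_dist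
  obtain ⟨v, hv, hv1, hv2⟩ := exists_word_of_walk q
  exact ⟨v, hv, by simpa using hv1, hv2.trans hq⟩

theorem wordLength_mul_le {G : Type*} [Group G] {S : Set G} (hS : Subgroup.closure S = ⊤)
    (g h : G) : wordLength S (g * h) ≤ wordLength S g + wordLength S h := by
  obtain ⟨v, hv, rfl, hvl⟩ := exists_word hS g
  obtain ⟨w, hw, rfl, hwl⟩ := exists_word hS h
  rw [← hvl, ← hwl, ← List.prod_append, ← List.length_append]
  refine wordLength_le _ fun x hx => ?_
  rcases List.mem_append.1 hx with h | h
  exacts [hv x h, hw x h]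

theorem wordLength_inv_le {G : Type*} [Group G] {S : Set G} (hS : Subgroup.closure S = ⊤)
    (g : G) : wordLength S g⁻¹ ≤ wordLength S g := by
  obtain ⟨v, hv, rfl, hvl⟩ := exists_word hS g
  rw [← hvl, List.prod_inv_reverse]
  refine (wordLength_le _ fun x hx => ?_).trans (by simp)
  simp only [List.mem_reverse, List.mem_map] at hx
  obtain ⟨y, hy, rfl⟩ := hx
  simpa [or_comm] using hv y hy

/-- The largest word length of the image of a generator. -/
noncomputable def maxLength {G : Type*} [Group G] (S : Finset G) (ψ : MulAut G) : ℕ :=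
  S.sup fun s => wordLength (S : Set G) (ψ s)

theorem wordLength_apply_le {G : Type*} [Group G] {S : Finset G}
    (hS : Subgroup.closure (S : Set G) = ⊤) (ψ : MulAut G) (g : G) :
    wordLength (S : Set G) (ψ g) ≤ wordLength (S : Set G) g * maxLength S ψ := by
  obtain ⟨v, hv, rfl, hvl⟩ := exists_word hS g
  rw [← hvl]
  clear hvl
  induction v with
  | nil => simpa using wordLength_le (S := (S : Set G)) [] (by simp)
  | cons a v ih =>
    have ha : wordLength (S : Set G) (ψ a) ≤ maxLength S ψ := by
      rcases hv a (by simp) with h | h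
      · exact Finset.le_sup (f := fun s => wordLength (S : Set G) (ψ s)) (by simpa using h)
      · have h1 := wordLength_inv_le hS (ψ a⁻¹)
        rw [← map_inv, inv_inv] at h1
        exact h1.trans
          (Finset.le_sup (f := fun s => wordLength (S : Set G) (ψ s)) (by simpa using h))
    have h2 := ih fun x hx => hv x (by simp [hx])
    rw [List.prod_cons, map_mul, List.length_cons]
    calc _ ≤ _ := wordLength_mul_le hS _ _
      _ ≤ maxLength S ψ + v.length * maxLength S ψ := add_le_add ha h2
      _ = _ := by ring

theorem maxLength_mul_le {G : Type*} [Group G] {S : Finset G}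
    (hS : Subgroup.closure (S : Set G) = ⊤) (ψ χ : MulAut G) :
    maxLength S (ψ * χ) ≤ maxLength S ψ * maxLength S χ := by
  refine Finset.sup_le fun s hs => ?_
  rw [MulAut.mul_apply, mul_comm]
  exact (wordLength_apply_le hS ψ (χ s)).trans (Nat.mul_le_mul_right _
    (Finset.le_sup (f := fun s => wordLength (S : Set G) (χ s)) hs))

theorem entropy_eq_limsup {G : Type*} [Group G] (S : Finset G) (φ : MulAut G) :
    entropy S φ = limsup (fun n : ℕ => (maxLength S (φ ^ n) : ℝ≥0∞) ^ ((n : ℝ)⁻¹)) atTop := by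
  unfold entropy growthRate
  rw [← limsup_finset_sup]
  refine Filter.limsup_congr ?_
  filter_upwards [eventually_gt_atTop 0] with n hn
  have hn' : (0 : ℝ) < (n : ℝ)⁻¹ := by positivity
  have hm : Monotone fun k : ℕ => (k : ℝ≥0∞) ^ ((n : ℝ)⁻¹) := fun a b h =>
    ENNReal.rpow_le_rpow (by exact_mod_cast h) hn'.le
  exact (Finset.apply_sup_eq_sup_comp_of_linearOrder _ hm (by simp [hn])).symm

/-- The entropy is a genuine limit, and it is finite. -/
theorem tendsto_entropy {G : Type*} [Group G] {S : Finset G}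
    (hS : Subgroup.closure (S : Set G) = ⊤) (φ : MulAut G) :
    Tendsto (fun n : ℕ => (maxLength S (φ ^ n) : ℝ≥0∞) ^ ((n : ℝ)⁻¹)) atTop (𝓝 (entropy S φ)) ∧
      entropy S φ ≠ ∞ := by
  suffices h : ∃ K : ℝ≥0∞, K ≠ ∞ ∧
      Tendsto (fun n : ℕ => (maxLength S (φ ^ n) : ℝ≥0∞) ^ ((n : ℝ)⁻¹)) atTop (𝓝 K) by
    obtain ⟨K, hK, h⟩ := h
    have h1 : entropy S φ = K := by rw [entropy_eq_limsup, h.limsup_eq]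
    rw [h1]
    exact ⟨h, hK⟩
  have hmul : ∀ m n : ℕ, maxLength S (φ ^ (m + n)) ≤
      maxLength S (φ ^ m) * maxLength S (φ ^ n) := fun m n => by
    rw [pow_add]
    exact maxLength_mul_le hS _ _
  by_cases hz : ∃ m, maxLength S (φ ^ m) = 0
  · obtain ⟨m, hm⟩ := hz
    refine ⟨0, by simp, tendsto_const_nhds.congr' ?_⟩
    filter_upwards [eventually_ge_atTop m, eventually_gt_atTop 0] with n hn hn0
    have h := hmul m (n - m)
    rw [hm, zero_mul, Nat.add_sub_cancel' hn, Nat.le_zero] at h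
    simp [h, hn0]
  · push Not at hz
    have hpos : ∀ m, (0 : ℝ) < maxLength S (φ ^ m) := fun m => by
      exact_mod_cast Nat.pos_of_ne_zero (hz m)
    have hsub : Subadditive fun n : ℕ => Real.log (maxLength S (φ ^ n)) := fun m n => by
      rw [← Real.log_mul (hpos m).ne' (hpos n).ne']
      exact Real.log_le_log (hpos _) (by exact_mod_cast hmul m n)
    have hlim := hsub.tendsto_lim ⟨0, by
      rintro _ ⟨n, rfl⟩
      exact div_nonneg (Real.log_nonneg (by exact_mod_cast Nat.pos_of_ne_zero (hz n)))
        (by positivity)⟩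
    refine ⟨ENNReal.ofReal (Real.exp hsub.lim), by simp,
      (ENNReal.tendsto_ofReal ((Real.continuous_exp.tendsto _).comp hlim)).congr fun n => ?_⟩
    rw [Function.comp_apply, div_eq_mul_inv, ← Real.rpow_def_of_pos (hpos _),
      ← ENNReal.ofReal_rpow_of_pos (hpos _), ENNReal.ofReal_natCast]

theorem entropy_eq_of_tendsto {G : Type*} [Group G] (S : Finset G) (φ : MulAut G) (L : G → ℝ≥0∞)
    (hL : ∀ s ∈ S, Tendsto
      (fun n : ℕ => (wordLength (S : Set G) ((φ ^ n) s) : ℝ≥0∞) ^ ((n : ℝ)⁻¹)) atTop (𝓝 (L s))) :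
    entropy S φ = S.sup L :=
  Finset.sup_congr rfl fun s hs => (hL s hs).limsup_eq

end WordEntropy

/-!
The entropy of `φ` dominates that of the abelianization, since lengths do not grow under the
projection. For the converse, it suffices to find a constant `D` such that for each automorphism `ψ`
that maps the generators, modulo `[N, N]`, to elements of length at most `L`, one has
`ℓ(ψ g) ≤ D * L * ℓ(g) + β` with `D` independent of `ψ` and `L`
(`WordEntropy.exists_wordLength_apply_le`). Applied to `ψ = φ ^ m` and iterated, this bounds
`entropy φ ^ m` by `D * L_m`, where `L_m` is the largest length modulo `[N, N]` of the image of a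
generator under `φ ^ m`; the constant `D` disappears in the `m`-th root.

The constant comes from the distortion of the lower central series. An element of length `R` is
viewed at scale `t = 1 / R`: in a product of iterated commutators of generators, a commutator of
weight `j` costs `t ^ j` (`WeightedWord.Word`). Words of bounded cost at scale `t` are stable under
products, conjugation and commutators, with weights adding up and costs multiplying, and
collecting equal letters changes the cost by a bounded factor only. A power `x ^ k` with
`k = O(R ^ i)` of a commutator `x` of weight `i` is, up to heavier words of bounded cost, a bounded
product of powers `s ^ l` of generators with `l = O(R)`, because `⁅y, z⁆ ^ (a * b)` agrees with
`⁅y ^ a, z ^ b⁆` up to such words. By descending induction on the weight, words of bounded cost at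
scale `1 / R` are bounded products of powers `s ^ l` with `l ≤ R`, as far as any length function can
tell (`WeightedWord.boundedOn_from`). It therefore suffices to bound `ℓ(ψ (s ^ k))`. Write
`ψ s = c * u` with `c ∈ [N, N]` and `ℓ(u) ≤ L`. Then `(c * u) ^ k = f * u ^ k`, where `f` is a word
in letters of weight at least `2` whose cost at scale `1 / (k * L)` tends to `0` as `k` grows; so
`ℓ(f) = O(k * L)` with a constant that does not depend on `c`.

For an infinite finitely generated abelian group `A`, the group is a lattice in `ℂ ⊗ A` up to a
finite kernel, so word lengths are comparable to norms, and the entropy is the spectral radius by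
Gelfand's formula. Torsion-freeness is needed only when the abelianization is finite: then all
successive quotients of the lower central series have finite exponent, and `N` is trivial.
-/

/-! ### Iterated commutators and weighted words -/

namespace WeightedWord

open scoped commutatorElement

/-- `Letter S j x`: the element `x` is an iterated commutator, bracketed in any way, of `j` elements
of `S ∪ S⁻¹`; the number `j` is its weight. -/
inductive Letter {N : Type*} [Group N] (S : Set N) : ℕ → N → Prop
  | gen {s : N} : s ∈ S → Letter S 1 s
  | inv {s : N} : s ∈ S → Letter S 1 s⁻¹
  | comm {i j : ℕ} {x y : N} : Letter S i x → Letter S j y → Letter S (i + j) ⁅x, y⁆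

/-- `Word A t κ g`: the element `g` is a product of letters `x` of weights `j` with `A j x`, and
the sum of the costs `t ^ j` of these letters is at most `κ`. With `t = 1 / R` this says that there
are `O(R ^ j)` letters of weight `j`. -/
inductive Word {N : Type*} [Group N] (A : ℕ → N → Prop) (t : ℝ) : ℝ → N → Prop
  | one {κ : ℝ} : 0 ≤ κ → Word A t κ 1
  | cons {j : ℕ} {κ κ' : ℝ} {x g : N} :
      A j x → Word A t κ g → t ^ j + κ ≤ κ' → Word A t κ' (x * g)

/-- The letters of weight at least `p`. -/
def From {N : Type*} [Group N] (S : Set N) (p : ℕ) (j : ℕ) (x : N) : Prop :=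
  Letter S j x ∧ p ≤ j

theorem Letter.pos {N : Type*} [Group N] {S : Set N} {j : ℕ} {x : N} (h : Letter S j x) :
    1 ≤ j := by
  induction h <;> omega

theorem Letter.inv_mem {N : Type*} [Group N] {S : Set N} {j : ℕ} {x : N} (h : Letter S j x) :
    Letter S j x⁻¹ := by
  cases h with
  | gen hs => exact .inv hs
  | inv hs => rw [inv_inv]; exact .gen hs
  | comm hx hy => rw [commutatorElement_inv, add_comm]; exact .comm hy hx

/-- One of the two factors of a commutator of weight more than `2 ^ (k + 1)` has weight more than
`2 ^ k`, so heavy letters lie deep in the lower central series. -/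
theorem Letter.mem_lowerCentralSeries {N : Type*} [Group N] {S : Set N} {j : ℕ} {x : N}
    (h : Letter S j x) : ∀ k, 2 ^ k < j → x ∈ (⊤ : Subgroup N).lowerCentralSeries k := by
  induction h with
  | gen hs => intro k hk; have := Nat.one_le_two_pow (n := k); omega
  | inv hs => intro k hk; have := Nat.one_le_two_pow (n := k); omega
  | @comm i j x y hx hy ihx ihy =>
    intro k hk
    cases k with
    | zero => simp
    | succ k =>
      rw [pow_succ] at hk
      rcases lt_or_ge (2 ^ k) i with hi | hi
      · exact Subgroup.commutator_mem_commutator (ihx k hi) (Subgroup.mem_top y)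
      · rw [← commutatorElement_inv]
        exact Subgroup.inv_mem _
          (Subgroup.commutator_mem_commutator (ihy k (by omega)) (Subgroup.mem_top x))

theorem finite_letter {N : Type*} [Group N] {S : Set N} (hS : S.Finite) (n : ℕ) :
    {x | Letter S n x}.Finite := by
  induction n using Nat.strong_induction_on with
  | _ n ih =>
    have hfin : (S ∪ S⁻¹ ∪ ⋃ i ∈ Finset.range n, ⋃ j ∈ Finset.range n,
        Set.image2 (fun x y : N => ⁅x, y⁆) {x | Letter S i x} {x | Letter S j x}).Finite := by
      refine (hS.union hS.inv).union ?_
      refine Set.Finite.biUnion (Finset.finite_toSet _) fun i hi => ?_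
      refine Set.Finite.biUnion (Finset.finite_toSet _) fun j hj => ?_
      exact Set.Finite.image2 _ (ih i (by simpa using hi)) (ih j (by simpa using hj))
    refine hfin.subset fun x hx => ?_
    rcases hx with hs | hs | @⟨i, j, x, y, hx, hy⟩
    · exact Or.inl (Or.inl hs)
    · exact Or.inl (Or.inr (by simpa using hs))
    · refine Or.inr ?_
      have := hx.pos
      have := hy.pos
      simp only [Set.mem_iUnion]
      exact ⟨i, by simp; omega, j, by simp; omega, x, hx, y, hy, rfl⟩

namespace Word

variable {N : Type*} [Group N] {S : Set N} {A : ℕ → N → Prop} {t κ κ' : ℝ} {g h : N} {p q : ℕ}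

theorem nonneg (ht : 0 ≤ t) (hg : Word A t κ g) : 0 ≤ κ := by
  induction hg with
  | one h => exact h
  | @cons j κ κ' x g hx hg hκ ih => have := pow_nonneg ht j; linarith

theorem mono (hg : Word A t κ g) (h : κ ≤ κ') : Word A t κ' g := by
  cases hg with
  | one h0 => exact .one (h0.trans h)
  | cons hx hg hκ => exact .cons hx hg (hκ.trans h)

theorem imp {A' : ℕ → N → Prop} (hA : ∀ j x, A j x → A' j x) (hg : Word A t κ g) :
    Word A' t κ g := by
  induction hg with
  | one h => exact .one h
  | cons hx _ hκ ih => exact .cons (hA _ _ hx) ih hκ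

theorem weaken (hg : Word (From S p) t κ g) (h : q ≤ p) : Word (From S q) t κ g :=
  hg.imp fun _ _ hx => ⟨hx.1, h.trans hx.2⟩

theorem letter {j : ℕ} {x : N} (hx : A j x) : Word A t (t ^ j) x := by
  simpa using Word.cons hx (.one le_rfl) (add_zero (t ^ j)).le

theorem mul (hg : Word A t κ g) (hh : Word A t κ' h) : Word A t (κ + κ') (g * h) := by
  induction hg with
  | one h0 => rw [one_mul]; exact hh.mono (by linarith)
  | cons hx _ hκ ih => rw [mul_assoc]; exact .cons hx ih (by linarith)

theorem pow (hg : Word A t κ g) (n : ℕ) : Word A t (n * κ) (g ^ n) := by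
  induction n with
  | zero => simpa using Word.one le_rfl
  | succ n ih => rw [pow_succ]; exact (ih.mul hg).mono (by push_cast; linarith)

theorem inv (hg : Word (From S p) t κ g) : Word (From S p) t κ g⁻¹ := by
  induction hg with
  | one h => simpa using Word.one h
  | cons hx _ hκ ih =>
    rw [mul_inv_rev]
    exact (ih.mul (letter (A := From S p) ⟨hx.1.inv_mem, hx.2⟩)).mono (by linarith)

/-- Conjugation by a letter `y` replaces each letter `x` by `⁅y, x⁆ * x`. -/
theorem conj_letter (ht : 0 ≤ t) {j : ℕ} {y : N} (hA : ∀ k x, A k x → A (j + k) ⁅y, x⁆)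
    (hg : Word A t κ g) : Word A t ((1 + t ^ j) * κ) (y * g * y⁻¹) := by
  have hy : 0 ≤ 1 + t ^ j := by positivity
  induction hg with
  | one h => simpa using Word.one (mul_nonneg hy h)
  | @cons k κ κ' x g hx hg hκ ih =>
    have e : y * (x * g) * y⁻¹ = ⁅y, x⁆ * (x * (y * g * y⁻¹)) := by
      rw [commutatorElement_def]; group
    rw [e]
    refine .cons (hA _ _ hx) (.cons hx ih le_rfl) ?_
    have := mul_le_mul_of_nonneg_left hκ hy
    rw [pow_add]
    linarith

theorem conj_letter_from (ht : 0 ≤ t) {j : ℕ} {y : N} (hy : Letter S j y)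
    (hg : Word (From S p) t κ g) : Word (From S p) t ((1 + t ^ j) * κ) (y * g * y⁻¹) :=
  conj_letter ht (fun _ _ hx => ⟨.comm hy hx.1, hx.2.trans (Nat.le_add_left _ _)⟩) hg

/-- Conjugation by a word of cost `κ'` multiplies the cost by at most `exp κ'`. -/
theorem conj (ht : 0 ≤ t) (hh : Word (From S q) t κ' h) (hg : Word (From S p) t κ g) :
    Word (From S p) t (κ * Real.exp κ') (h * g * h⁻¹) := by
  have hκ0 := hg.nonneg ht
  induction hh with
  | one h0 =>
    simp only [one_mul, inv_one, mul_one]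
    exact hg.mono (le_mul_of_one_le_right hκ0 (Real.one_le_exp h0))
  | @cons j κ₁ κ₂ x h hx hh hκ ih =>
    have e : x * h * g * (x * h)⁻¹ = x * (h * g * h⁻¹) * x⁻¹ := by group
    rw [e]
    refine (conj_letter_from ht hx.1 ih).mono ?_
    calc (1 + t ^ j) * (κ * Real.exp κ₁) ≤ Real.exp (t ^ j) * (κ * Real.exp κ₁) := by
          have := Real.add_one_le_exp (t ^ j)
          gcongr
          linarith
      _ = κ * Real.exp (t ^ j + κ₁) := by rw [Real.exp_add]; ring
      _ ≤ _ := by gcongr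

theorem comm_letter (ht : 0 ≤ t) {j : ℕ} {x : N} (hx : Letter S j x)
    (hpj : p ≤ j) (hh : Word (From S q) t κ' h) :
    Word (From S (p + q)) t (t ^ j * κ' * Real.exp κ') ⁅x, h⁆ := by
  induction hh with
  | one h0 => rw [commutatorElement_one_right]; exact .one (by positivity)
  | @cons i κ₁ κ₂ y h hy hh hκ ih =>
    have e : ⁅x, y * h⁆ = ⁅x, y⁆ * (y * ⁅x, h⁆ * y⁻¹) := by
      simp only [commutatorElement_def]; group
    have h1 : 0 ≤ κ₁ := hh.nonneg ht
    have h2 : 1 ≤ Real.exp (t ^ i + κ₁) := Real.one_le_exp (by positivity)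
    have h4 : 0 ≤ κ₂ := hκ.trans' (by positivity)
    have h3 : (1 + t ^ i) * Real.exp κ₁ ≤ Real.exp (t ^ i + κ₁) := by
      rw [Real.exp_add]
      gcongr
      linarith [Real.add_one_le_exp (t ^ i)]
    rw [e]
    refine .cons ⟨.comm hx hy.1, add_le_add hpj hy.2⟩ (conj_letter_from ht hy.1 ih) ?_
    calc t ^ (j + i) + (1 + t ^ i) * (t ^ j * κ₁ * Real.exp κ₁)
        = t ^ j * (t ^ i * 1 + κ₁ * ((1 + t ^ i) * Real.exp κ₁)) := by rw [pow_add]; ring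
      _ ≤ t ^ j * (t ^ i * Real.exp (t ^ i + κ₁) + κ₁ * Real.exp (t ^ i + κ₁)) := by gcongr
      _ = t ^ j * (t ^ i + κ₁) * Real.exp (t ^ i + κ₁) := by ring
      _ ≤ t ^ j * κ₂ * Real.exp κ₂ := by gcongr

/-- In a commutator the weights add up and the costs multiply, up to a factor that is bounded for
bounded costs. -/
theorem comm (ht : 0 ≤ t) (hg : Word (From S p) t κ g) (hh : Word (From S q) t κ' h) :
    Word (From S (p + q)) t (κ * κ' * Real.exp (κ + κ')) ⁅g, h⁆ := by
  have h0 := hh.nonneg ht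
  induction hg with
  | one hκ => rw [commutatorElement_one_left]; exact .one (by positivity)
  | @cons i κ₁ κ₂ x g hx hg hκ ih =>
    have e : ⁅x * g, h⁆ = (x * ⁅g, h⁆ * x⁻¹) * ⁅x, h⁆ := by
      simp only [commutatorElement_def]; group
    have h1 : 0 ≤ κ₁ := hg.nonneg ht
    have ht' : 0 ≤ t ^ i := by positivity
    have h4 : 0 ≤ κ₂ := hκ.trans' (by positivity)
    have h3 : (1 + t ^ i) * Real.exp (κ₁ + κ') ≤ Real.exp (t ^ i + κ₁ + κ') := by
      rw [add_assoc, Real.exp_add (t ^ i)]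
      gcongr
      linarith [Real.add_one_le_exp (t ^ i)]
    rw [e]
    refine ((conj_letter_from ht hx.1 ih).mul (comm_letter ht hx.1 hx.2 hh)).mono ?_
    calc (1 + t ^ i) * (κ₁ * κ' * Real.exp (κ₁ + κ')) + t ^ i * κ' * Real.exp κ'
        = κ₁ * κ' * ((1 + t ^ i) * Real.exp (κ₁ + κ')) + t ^ i * κ' * Real.exp κ' := by ring
      _ ≤ κ₁ * κ' * Real.exp (t ^ i + κ₁ + κ') + t ^ i * κ' * Real.exp (t ^ i + κ₁ + κ') := by
          gcongr
          linarith
      _ = (t ^ i + κ₁) * κ' * Real.exp (t ^ i + κ₁ + κ') := by ring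
      _ ≤ κ₂ * κ' * Real.exp (κ₂ + κ') := by gcongr

/-- Passing from cost parameter `1` to `t` gains the factor `t ^ p`. -/
theorem rescale (ht : 0 ≤ t) (ht1 : t ≤ 1) (hg : Word (From S p) 1 κ g) :
    Word (From S p) t (κ * t ^ p) g := by
  induction hg with
  | one h => exact .one (by positivity)
  | @cons j κ₁ κ₂ x g hx hg hκ ih =>
    refine .cons hx ih ?_
    have h1 : t ^ j ≤ t ^ p := pow_le_pow_of_le_one ht ht1 hx.2
    have h2 : (1 + κ₁) * t ^ p ≤ κ₂ * t ^ p := by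
      gcongr
      simpa using hκ
    linarith

theorem eq_one {n k : ℕ} (hk : (⊤ : Subgroup N).lowerCentralSeries k = ⊥) (hn : 2 ^ k < n)
    (hg : Word (From S n) t κ g) : g = 1 := by
  induction hg with
  | one => rfl
  | cons hx _ _ ih =>
    have := hx.1.mem_lowerCentralSeries k (hn.trans_le hx.2)
    rw [hk, Subgroup.mem_bot] at this
    rw [this, ih, mul_one]

theorem of_list (l : List N) (hl : ∀ x ∈ l, x ∈ S ∨ x⁻¹ ∈ S) :
    Word (From S 1) t (l.length * t) l.prod := by
  induction l with
  | nil => exact .one (by simp)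
  | cons a l ih =>
    have ha : Letter S 1 a := by
      rcases hl a (by simp) with h | h
      · exact .gen h
      · simpa using Letter.inv h
    refine .cons (A := From S 1) ⟨ha, le_rfl⟩ (ih fun x hx => hl x (by simp [hx])) ?_
    rw [List.length_cons]
    push_cast
    linarith

theorem of_wordLength (hS : Subgroup.closure S = ⊤) (g : N) :
    Word (From S 1) t (WordEntropy.wordLength S g * t) g := by
  obtain ⟨w, hw, rfl, hl⟩ := WordEntropy.exists_word hS g
  rw [← hl]
  exact of_list w hw

theorem of_mem_commutator (hS : Subgroup.closure S = ⊤) (hg : g ∈ commutator N) :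
    ∃ κ, Word (From S 2) 1 κ g := by
  rw [commutator_eq_closure] at hg
  induction hg using Subgroup.closure_induction with
  | mem x hx =>
    obtain ⟨a, b, rfl⟩ := hx
    exact ⟨_, (of_wordLength hS a).comm zero_le_one (of_wordLength hS b)⟩
  | one => exact ⟨0, .one le_rfl⟩
  | mul x y _ _ hx hy =>
    obtain ⟨κ, hx⟩ := hx
    obtain ⟨κ', hy⟩ := hy
    exact ⟨_, hx.mul hy⟩
  | inv x _ hx =>
    obtain ⟨κ, hx⟩ := hx
    exact ⟨_, hx.inv⟩

/-- Moving all factors `d` of the product of the elements `e j * d` to the right. -/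
theorem collect (ht : 0 ≤ t) {ε δ : ℝ} {d : N} {e G : ℕ → N} {n : ℕ}
    (hd : Word (From S q) t ε d) (he : ∀ j < n, Word (From S p) t δ (e j)) (hG0 : G 0 = 1)
    (hG : ∀ j < n, G (j + 1) = G j * e j * d) :
    ∃ f, Word (From S p) t (n * δ * Real.exp (n * ε)) f ∧ G n = f * d ^ n := by
  have hε := hd.nonneg ht
  have main : ∀ k ≤ n, ∃ f, Word (From S p) t (k * (δ * Real.exp (n * ε))) f ∧
      G k = f * d ^ k := by
    intro k
    induction k with
    | zero => exact fun _ => ⟨1, .one (by simp), by simp [hG0]⟩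
    | succ k ih =>
      intro hk
      obtain ⟨f, hf, hGf⟩ := ih (by omega)
      have hek := he k (by omega)
      have hδ := hek.nonneg ht
      refine ⟨f * (d ^ k * e k * (d ^ k)⁻¹), (hf.mul (conj ht (hd.pow k) hek)).mono ?_, ?_⟩
      · have : Real.exp (k * ε) ≤ Real.exp (n * ε) := by
          gcongr
          omega
        have := mul_le_mul_of_nonneg_left this hδ
        push_cast
        linarith
      · rw [hG k (by omega), hGf, pow_succ]
        group
  obtain ⟨f, hf, h⟩ := main n le_rfl
  exact ⟨f, hf.mono (le_of_eq (by ring)), h⟩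

/-- Modulo heavier words, a commutator with a power is the power of the commutator. -/
theorem comm_pow_right (ht : 0 ≤ t) (ht1 : t ≤ 1) {η : ℝ} {a : ℕ} {y : N}
    (hy : Letter S p y) (ha : a * t ^ p ≤ κ) (hη : η ≤ κ) (hh : Word (From S q) t η h) :
    ∃ f, Word (From S (p + q + 1)) t
      (η * (κ ^ 2 * Real.exp (κ + 1) * Real.exp (κ + κ * Real.exp (κ + 1)) *
        Real.exp (κ * κ * Real.exp (κ + 1)))) f ∧ ⁅h, y ^ a⁆ = f * ⁅h, y⁆ ^ a := by
  have hη0 := hh.nonneg ht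
  have hκ0 := hη0.trans hη
  have hy' : Word (From S p) t (t ^ p) y := letter (A := From S p) ⟨hy, le_rfl⟩
  have htp : t ^ p ≤ 1 := pow_le_one₀ ht ht1
  have htp0 : 0 ≤ t ^ p := by positivity
  set E := Real.exp (κ + 1) with hE
  have hE0 : 0 < E := Real.exp_pos _
  have hd : Word (From S (q + p)) t (η * t ^ p * E) ⁅h, y⁆ := by
    refine (hh.comm ht hy').mono ?_
    have : Real.exp (η + t ^ p) ≤ E := Real.exp_le_exp.2 (by linarith)
    gcongr
  have hε1 : η * t ^ p * E ≤ κ * E := by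
    gcongr
    exact (mul_le_of_le_one_right hη0 htp).trans hη
  have he : ∀ j < a, Word (From S (p + q + 1)) t
      (κ * (η * t ^ p * E) * Real.exp (κ + κ * E)) ⁅y ^ j, ⁅h, y⁆⁆ := by
    intro j hj
    have hyj : Word (From S p) t κ (y ^ j) := (hy'.pow j).mono (le_trans (by gcongr) ha)
    have := hy.pos
    refine ((hyj.comm ht hd).mono ?_).weaken (by omega)
    gcongr
  obtain ⟨f, hf, hG⟩ := collect (G := fun j => ⁅h, y ^ j⁆) ht hd he (by simp) (fun j _ => by
    simp only [commutatorElement_def, pow_succ]; group)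
  refine ⟨f, hf.mono ?_, hG⟩
  have h1 : a * (η * t ^ p * E) ≤ κ * κ * E := by
    calc a * (η * t ^ p * E) = η * (a * t ^ p) * E := by ring
      _ ≤ _ := by gcongr
  calc a * (κ * (η * t ^ p * E) * Real.exp (κ + κ * E)) * Real.exp (a * (η * t ^ p * E))
      = η * (κ * (a * t ^ p) * E * Real.exp (κ + κ * E) * Real.exp (a * (η * t ^ p * E))) := by
        ring
    _ ≤ η * (κ * κ * E * Real.exp (κ + κ * E) * Real.exp (κ * κ * E)) := by gcongr
    _ = _ := by ring

/-- Modulo words of bounded cost and larger weight, `⁅y ^ a, z ^ b⁆` is `⁅y, z⁆ ^ (a * b)`. -/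
theorem exists_comm_pow (κ : ℝ) (hκ : 1 ≤ κ) : ∃ K : ℝ, ∀ {N : Type*} [Group N] {S : Set N}
    {t : ℝ} {p q a b : ℕ} {y z : N}, 0 ≤ t → t ≤ 1 → Letter S p y → Letter S q z →
    a * t ^ p ≤ κ → b * t ^ q ≤ κ →
    ∃ f, Word (From S (p + q + 1)) t K f ∧ ⁅y ^ a, z ^ b⁆ = f * ⁅y, z⁆ ^ (a * b) := by
  set K₁ := κ ^ 2 * Real.exp (κ + 1) * Real.exp (κ + κ * Real.exp (κ + 1)) *
    Real.exp (κ * κ * Real.exp (κ + 1)) with hK₁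
  have hK₁0 : 0 ≤ K₁ := by positivity
  refine ⟨κ * K₁ * Real.exp (κ * (κ * Real.exp (2 * κ))) + κ * K₁ * Real.exp (κ * κ), ?_⟩
  intro N _ S t p q a b y z ht ht1 hy hz ha hb
  have hy' : Word (From S p) t (t ^ p) y := letter (A := From S p) ⟨hy, le_rfl⟩
  have hz' : Word (From S q) t (t ^ q) z := letter (A := From S q) ⟨hz, le_rfl⟩
  have htp : t ^ p ≤ 1 := pow_le_one₀ ht ht1
  have htp0 : 0 ≤ t ^ p := by positivity
  have hzb : Word (From S q) t κ (z ^ b) := (hz'.pow b).mono hb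
  have hx : Word (From S (p + q)) t (t ^ (p + q)) ⁅y, z⁆ :=
    letter (A := From S (p + q)) ⟨.comm hy hz, le_rfl⟩
  -- First expand in `z`: `⁅y, z ^ b⁆ = f₁ * ⁅y, z⁆ ^ b`, where the cost of `f₁` is `O(t ^ p)`.
  obtain ⟨f₁, hf₁, e₁⟩ := comm_pow_right ht ht1 hz hb (htp.trans hκ) hy'
  -- Then in `y`: `⁅z ^ b, y ^ a⁆ = f₂ * ⁅z ^ b, y⁆ ^ a`.
  obtain ⟨f₂, hf₂, e₂⟩ := comm_pow_right ht ht1 hy ha le_rfl hzb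
  -- Finally the `a`-th power of `f₁ * ⁅y, z⁆ ^ b` is collected.
  have hxb : Word (From S (p + q)) t (κ * t ^ p) (⁅y, z⁆ ^ b) := by
    refine (hx.pow b).mono ?_
    calc b * t ^ (p + q) = b * t ^ q * t ^ p := by rw [pow_add]; ring
      _ ≤ _ := by gcongr
  obtain ⟨f₃, hf₃, e₃⟩ := collect (G := fun j => (f₁ * ⁅y, z⁆ ^ b) ^ j) (n := a)
    (e := fun _ => f₁) ht hxb (fun _ _ => hf₁) (by simp) (fun j _ => by
      simp only [pow_succ]; group)
  have hv : Word (From S (p + q)) t (a * (t ^ p * κ * Real.exp (2 * κ))) (⁅y, z ^ b⁆ ^ a) := by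
    refine ((hy'.comm ht hzb).mono ?_).pow a
    gcongr
    linarith
  refine ⟨⁅y, z ^ b⁆ ^ a * f₂⁻¹ * (⁅y, z ^ b⁆ ^ a)⁻¹ * f₃, ?_, ?_⟩
  · refine ((conj ht hv (hf₂.inv.weaken (by omega))).mul (hf₃.weaken (by omega))).mono ?_
    have h1 : a * (t ^ p * κ * Real.exp (2 * κ)) ≤ κ * (κ * Real.exp (2 * κ)) := by
      calc _ = a * t ^ p * (κ * Real.exp (2 * κ)) := by ring
        _ ≤ _ := by gcongr
    have h2 : a * (κ * t ^ p) ≤ κ * κ := by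
      calc _ = κ * (a * t ^ p) := by ring
        _ ≤ _ := by gcongr
    have h3 : a * (t ^ p * K₁) ≤ κ * K₁ := by
      rw [← mul_assoc]
      gcongr
    gcongr
  · have e₄ : ⁅y ^ a, z ^ b⁆ = ⁅y, z ^ b⁆ ^ a * f₂⁻¹ := by
      rw [← commutatorElement_inv, e₂, mul_inv_rev, ← inv_pow, commutatorElement_inv]
    have e₅ : ⁅y, z ^ b⁆ ^ a = f₃ * ⁅y, z⁆ ^ (a * b) := by
      rw [e₁, mul_comm a b, pow_mul]
      exact e₃
    rw [mul_assoc _ f₃, ← e₅, e₄]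
    group

end Word
end WeightedWord

/-! ### Length functions on words of bounded cost -/

namespace WeightedWord

open scoped commutatorElement

/-- The function `q` behaves like a word length, and it is at most `Q` on the powers `s ^ k` with
`s ∈ S` and `k ≤ R`. -/
structure PowerBounded {N : Type*} [Group N] (S : Set N) (q : N → ℝ) (R : ℕ) (Q : ℝ) : Prop where
  nonneg : 0 ≤ Q
  map_one : q 1 ≤ 0
  map_mul : ∀ g h, q (g * h) ≤ q g + q h
  map_inv : ∀ g, q g⁻¹ ≤ q g
  map_pow : ∀ s ∈ S, ∀ k ≤ R, q (s ^ k) ≤ Q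

/-- On the words in the letters of `A` of cost at most `κ` with respect to `t = 1 / R`, each length
function that is at most `Q` on the powers `s ^ k` of generators with `k ≤ R` is at most `C * Q`.
The point is that `C` depends neither on `R` nor on the length function. -/
def BoundedOn {N : Type*} [Group N] (S : Set N) (A : ℕ → N → Prop) : Prop :=
  ∀ κ : ℝ, ∃ C : ℝ, 0 ≤ C ∧ ∀ (R : ℕ) (q : N → ℝ) (Q : ℝ), 1 ≤ R → PowerBounded S q R Q →
    ∀ g, Word A (R : ℝ)⁻¹ κ g → q g ≤ C * Q

/-- The powers `x ^ k` with `k = O(R ^ i)` agree, up to words of bounded cost in letters of weight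
more than `i`, with elements on which length functions are bounded. -/
def PowApprox {N : Type*} [Group N] (S : Set N) (i : ℕ) (x : N) : Prop :=
  ∀ κ : ℝ, ∃ C κ' : ℝ, 0 ≤ C ∧ ∀ (R : ℕ) (q : N → ℝ) (Q : ℝ), 1 ≤ R → PowerBounded S q R Q →
    ∀ k : ℕ, k * (R : ℝ)⁻¹ ^ i ≤ κ →
      ∃ e h, x ^ k = e * h ∧ Word (From S (i + 1)) (R : ℝ)⁻¹ κ' e ∧ q h ≤ C * Q

variable {N : Type*} [Group N] {S : Set N}

theorem PowerBounded.pow_le {q : N → ℝ} {R : ℕ} {Q : ℝ} (hq : PowerBounded S q R Q) (g : N)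
    (n : ℕ) : q (g ^ n) ≤ n * q g := by
  induction n with
  | zero => simpa using hq.map_one
  | succ n ih =>
    rw [pow_succ]
    push_cast
    linarith [hq.map_mul (g ^ n) g]

theorem PowerBounded.gen_pow_le {q : N → ℝ} {R : ℕ} {Q κ : ℝ} (hq : PowerBounded S q R Q)
    (hR : 1 ≤ R) {s : N} (hs : s ∈ S) {k : ℕ} (hk : k * (R : ℝ)⁻¹ ^ 1 ≤ κ) :
    q (s ^ k) ≤ (|κ| + 1) * Q := by
  have hR0 : (0 : ℝ) < R := by exact_mod_cast hR
  have h1 : ((k / R : ℕ) : ℝ) ≤ |κ| := by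
    refine Nat.cast_div_le.trans (le_trans ?_ (le_abs_self κ))
    simpa [div_eq_mul_inv] using hk
  have h2 := hq.map_mul ((s ^ R) ^ (k / R)) (s ^ (k % R))
  rw [← pow_mul, ← pow_add, Nat.div_add_mod] at h2
  have h3 := hq.pow_le (s ^ R) (k / R)
  rw [← pow_mul] at h3
  have h4 := hq.map_pow s hs R le_rfl
  have h5 := hq.map_pow s hs (k % R) (Nat.mod_lt _ hR).le
  have h6 : ((k / R : ℕ) : ℝ) * q (s ^ R) ≤ |κ| * Q :=
    (mul_le_mul_of_nonneg_left h4 (by positivity)).trans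
      (mul_le_mul_of_nonneg_right h1 hq.nonneg)
  linarith

theorem PowApprox.gen {s : N} (hs : s ∈ S) : PowApprox S 1 s := fun κ =>
  ⟨|κ| + 1, 0, by positivity, fun _ _ _ hR hq k hk =>
    ⟨1, s ^ k, by simp, .one le_rfl, hq.gen_pow_le hR hs hk⟩⟩

theorem PowApprox.inv {s : N} (hs : s ∈ S) : PowApprox S 1 s⁻¹ := fun κ =>
  ⟨|κ| + 1, 0, by positivity, fun _ _ _ hR hq k hk =>
    ⟨1, s⁻¹ ^ k, by simp, .one le_rfl, by
      rw [inv_pow]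
      exact (hq.map_inv _).trans (hq.gen_pow_le hR hs hk)⟩⟩

/-- Powers of a commutator with exponents `a * b` are approximated by commutators of the elements
that approximate `y ^ a` and `z ^ b`. -/
theorem PowApprox.comm_mul {m n : ℕ} {y z : N} (hy : Letter S m y) (hz : Letter S n z)
    (hay : PowApprox S m y) (haz : PowApprox S n z) (κ : ℝ) (hκ : 1 ≤ κ) :
    ∃ C κ' : ℝ, 0 ≤ C ∧ ∀ (R : ℕ) (q : N → ℝ) (Q : ℝ), 1 ≤ R → PowerBounded S q R Q →
      ∀ a b : ℕ, a * (R : ℝ)⁻¹ ^ m ≤ κ → b * (R : ℝ)⁻¹ ^ n ≤ κ →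
        ∃ e h, ⁅y, z⁆ ^ (a * b) = e * h ∧ Word (From S (m + n + 1)) (R : ℝ)⁻¹ κ' e ∧
          q h ≤ C * Q := by
  obtain ⟨K, hK⟩ := Word.exists_comm_pow κ hκ
  obtain ⟨C₁, κ₁, hC₁, h₁⟩ := hay κ
  obtain ⟨C₂, κ₂, hC₂, h₂⟩ := haz κ
  set B := |κ₁| + |κ₂| + κ with hB
  set D := B * B * Real.exp (B + B) with hD
  refine ⟨2 * (C₁ + C₂), K + (B * D * Real.exp (B + D) + D * Real.exp D +
    (D + B * D * Real.exp (B + D))), by positivity, fun R q Q hR hq a b ha hb => ?_⟩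
  have ht : 0 ≤ (R : ℝ)⁻¹ := by positivity
  have ht1 : (R : ℝ)⁻¹ ≤ 1 := inv_le_one_of_one_le₀ (by exact_mod_cast hR)
  obtain ⟨f, hf, hfe⟩ := hK ht ht1 hy hz ha hb
  obtain ⟨e₁, g₁, hg₁, he₁, hq₁⟩ := h₁ R q Q hR hq a ha
  obtain ⟨e₂, g₂, hg₂, he₂, hq₂⟩ := h₂ R q Q hR hq b hb
  have hκ₁ := le_abs_self κ₁
  have hκ₂ := le_abs_self κ₂
  have hκ₁' := abs_nonneg κ₁
  have hκ₂' := abs_nonneg κ₂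
  have hya : Word (From S m) (R : ℝ)⁻¹ κ (y ^ a) :=
    ((Word.letter (A := From S m) ⟨hy, le_rfl⟩).pow a).mono ha
  have hzb : Word (From S n) (R : ℝ)⁻¹ κ (z ^ b) :=
    ((Word.letter (A := From S n) ⟨hz, le_rfl⟩).pow b).mono hb
  have hwg₁ : Word (From S m) (R : ℝ)⁻¹ B g₁ := by
    rw [show g₁ = e₁⁻¹ * y ^ a by rw [hg₁]; group]
    exact ((he₁.inv.weaken (by omega)).mul hya).mono (by linarith)
  have hwg₂ : Word (From S n) (R : ℝ)⁻¹ B g₂ := by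
    rw [show g₂ = e₂⁻¹ * z ^ b by rw [hg₂]; group]
    exact ((he₂.inv.weaken (by omega)).mul hzb).mono (by linarith)
  replace he₁ : Word (From S (m + 1)) (R : ℝ)⁻¹ B e₁ := he₁.mono (by linarith)
  replace he₂ : Word (From S (n + 1)) (R : ℝ)⁻¹ B e₂ := he₂.mono (by linarith)
  replace hzb : Word (From S n) (R : ℝ)⁻¹ B (z ^ b) := hzb.mono (by linarith)
  -- Replacing `y ^ a = e₁ * g₁` by `g₁` and `z ^ b = e₂ * g₂` by `g₂` in the commutator produces
  -- four factors, each a commutator with `e₁` or `e₂` and hence of weight more than `m + n`.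
  have hw := hwg₁.comm ht hzb
  have w₁ := (he₁.comm ht hw).weaken (show m + n + 1 ≤ _ by omega)
  have w₂ := (Word.conj ht hw (he₁.comm ht hzb)).weaken (show m + n + 1 ≤ _ by omega)
  have w₃ := (hwg₁.comm ht he₂).weaken (show m + n + 1 ≤ _ by omega)
  have w₄ := (he₂.comm ht (hwg₁.comm ht hwg₂)).weaken (show m + n + 1 ≤ _ by omega)
  refine ⟨_, ⁅g₁, g₂⁆, ?_, hf.inv.mul ((w₁.mul w₂).mul (w₃.mul w₄)), ?_⟩
  · have e : ⁅y, z⁆ ^ (a * b) = f⁻¹ * ⁅e₁ * g₁, z ^ b⁆ := by rw [← hg₁, hfe]; group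
    have e' : ⁅e₁ * g₁, z ^ b⁆ =
        ⁅e₁, ⁅g₁, z ^ b⁆⁆ * (⁅g₁, z ^ b⁆ * ⁅e₁, z ^ b⁆ * ⁅g₁, z ^ b⁆⁻¹) * ⁅g₁, z ^ b⁆ := by
      generalize z ^ b = Z
      simp only [commutatorElement_def]; group
    have e'' : ⁅g₁, e₂ * g₂⁆ = ⁅g₁, e₂⁆ * ⁅e₂, ⁅g₁, g₂⁆⁆ * ⁅g₁, g₂⁆ := by
      simp only [commutatorElement_def]; group
    rw [← hg₂] at e''
    rw [e, e']
    conv_lhs => rw [mul_assoc, mul_assoc]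
    rw [mul_assoc f⁻¹, mul_assoc _ (⁅g₁, e₂⁆ * _), ← e'']
    group
  · have h1 := hq.map_mul (g₁ * g₂ * g₁⁻¹) g₂⁻¹
    have h2 := hq.map_mul (g₁ * g₂) g₁⁻¹
    have h3 := hq.map_mul g₁ g₂
    have h4 := hq.map_inv g₁
    have h5 := hq.map_inv g₂
    rw [commutatorElement_def]
    linarith

theorem PowApprox.comm {m n : ℕ} {y z : N} (hy : Letter S m y) (hz : Letter S n z)
    (hay : PowApprox S m y) (haz : PowApprox S n z) : PowApprox S (m + n) ⁅y, z⁆ := by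
  intro κ
  set κ₀ := |κ| + 1 with hκ₀
  have hκ₀1 : 1 ≤ κ₀ := by linarith [abs_nonneg κ]
  obtain ⟨C, κ', hC, H⟩ := PowApprox.comm_mul hy hz hay haz κ₀ hκ₀1
  refine ⟨C + C, κ' + κ' * Real.exp (κ' + κ₀ * κ₀), by positivity,
    fun R q Q hR hq k hk => ?_⟩
  have hR0 : (0 : ℝ) < R := by exact_mod_cast hR
  have ht : 0 ≤ (R : ℝ)⁻¹ := by positivity
  have ht1 : (R : ℝ)⁻¹ ≤ 1 := inv_le_one_of_one_le₀ (by exact_mod_cast hR)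
  have hRn : (R : ℝ) ^ n * (R : ℝ)⁻¹ ^ n = 1 := by rw [← mul_pow, mul_inv_cancel₀ hR0.ne', one_pow]
  -- The exponent is a sum of two products, `k = (k / R ^ n) * R ^ n + 1 * (k % R ^ n)`.
  set a := k / R ^ n with ha
  set r := k % R ^ n with hr
  have hkar : a * R ^ n + r = k := by rw [mul_comm]; exact Nat.div_add_mod _ _
  have ha' : a * (R : ℝ)⁻¹ ^ m ≤ κ₀ := by
    have h1 : (a : ℝ) * R ^ n ≤ k := by exact_mod_cast Nat.div_mul_le_self k (R ^ n)
    calc a * (R : ℝ)⁻¹ ^ m = a * (R ^ n * (R : ℝ)⁻¹ ^ n) * (R : ℝ)⁻¹ ^ m := by rw [hRn, mul_one]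
      _ = a * R ^ n * (R : ℝ)⁻¹ ^ (m + n) := by rw [pow_add]; ring
      _ ≤ k * (R : ℝ)⁻¹ ^ (m + n) := by gcongr
      _ ≤ κ₀ := by linarith [le_abs_self κ]
  have hb' : ((R ^ n : ℕ) : ℝ) * (R : ℝ)⁻¹ ^ n ≤ κ₀ := by push_cast; rw [hRn]; exact hκ₀1
  have hr' : (r : ℝ) * (R : ℝ)⁻¹ ^ n ≤ κ₀ := by
    refine le_trans ?_ hb'
    gcongr
    exact (Nat.mod_lt _ (by positivity)).le
  have h1' : ((1 : ℕ) : ℝ) * (R : ℝ)⁻¹ ^ m ≤ κ₀ := by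
    rw [Nat.cast_one, one_mul]
    exact (pow_le_one₀ ht ht1).trans hκ₀1
  obtain ⟨e₁, h₁, E₁, he₁, hq₁⟩ := H R q Q hR hq a (R ^ n) ha' hb'
  obtain ⟨e₂, h₂, E₂, he₂, hq₂⟩ := H R q Q hR hq 1 r h1' hr'
  have hwh : Word (From S (m + n)) (R : ℝ)⁻¹ (κ' + κ₀ * κ₀) h₁ := by
    rw [show h₁ = e₁⁻¹ * ⁅y, z⁆ ^ (a * R ^ n) by rw [E₁]; group]
    refine (he₁.inv.weaken (by omega)).mul (((Word.letter (A := From S (m + n))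
      ⟨.comm hy hz, le_rfl⟩).pow _).mono ?_)
    calc ((a * R ^ n : ℕ) : ℝ) * (R : ℝ)⁻¹ ^ (m + n)
        = (a * (R : ℝ)⁻¹ ^ m) * (((R ^ n : ℕ) : ℝ) * (R : ℝ)⁻¹ ^ n) := by
          push_cast; rw [pow_add]; ring
      _ ≤ κ₀ * κ₀ := by gcongr
  refine ⟨e₁ * (h₁ * e₂ * h₁⁻¹), h₁ * h₂, ?_, he₁.mul (Word.conj ht hwh he₂), ?_⟩
  · rw [← hkar, pow_add, E₁, ← one_mul r, E₂]
    group
  · linarith [hq.map_mul h₁ h₂]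

theorem Letter.powApprox {i : ℕ} {x : N} (hx : Letter S i x) : PowApprox S i x := by
  induction hx with
  | gen hs => exact .gen hs
  | inv hs => exact .inv hs
  | comm hx hy ihx ihy => exact .comm hx hy ihx ihy

/-- The letters of weight more than `i`, and those of weight `i` that lie in `B`. -/
def FromOr (S : Set N) (i : ℕ) (B : Set N) (j : ℕ) (x : N) : Prop :=
  Letter S j x ∧ (i + 1 ≤ j ∨ j = i ∧ x ∈ B)

/-- The letter `x` of weight `i` is moved to the right; the commutators that arise have larger
weight. -/
theorem Word.collect_letter {t κ : ℝ} (ht : 0 ≤ t) {i : ℕ} {B : Set N} {x : N} (hx : Letter S i x)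
    {g : N} (hg : Word (FromOr S i (insert x B)) t κ g) :
    ∃ (k : ℕ) (h : N), g = h * x ^ k ∧ k * t ^ i ≤ κ ∧
      Word (FromOr S i B) t (κ * Real.exp κ) h := by
  induction hg with
  | one h => exact ⟨0, 1, by simp, by simpa using h, .one (by positivity)⟩
  | @cons j κ₁ κ₂ y g hy hg hκ ih =>
    obtain ⟨k, h, rfl, hk, hh⟩ := ih
    have h0 := hg.nonneg ht
    have hj : 0 ≤ t ^ j := by positivity
    have hκ₂ : 0 ≤ κ₂ := by linarith
    have h1 : 1 ≤ Real.exp (t ^ j + κ₁) := Real.one_le_exp (by linarith)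
    have hexp : (t ^ j + κ₁) * Real.exp (t ^ j + κ₁) ≤ κ₂ * Real.exp κ₂ := by gcongr
    by_cases hyx : j = i ∧ y = x
    · obtain ⟨rfl, rfl⟩ := hyx
      have hpos := hx.pos
      refine ⟨k + 1, y * h * y⁻¹, by rw [pow_succ']; group, by push_cast; linarith, ?_⟩
      refine (hh.conj_letter (j := j) ht fun l x hx' =>
        ⟨.comm hx hx'.1, Or.inl (by have := hx'.1.pos; omega)⟩).mono ?_
      · refine le_trans ?_ hexp
        calc (1 + t ^ j) * (κ₁ * Real.exp κ₁) ≤ Real.exp (t ^ j) * (κ₁ * Real.exp κ₁) := by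
              gcongr
              linarith [Real.add_one_le_exp (t ^ j)]
          _ = κ₁ * Real.exp (t ^ j + κ₁) := by rw [Real.exp_add]; ring
          _ ≤ _ := by gcongr; linarith
    · refine ⟨k, y * h, by group, by linarith, .cons ⟨hy.1, ?_⟩ hh ?_⟩
      · rcases hy.2 with h | ⟨h, h'⟩
        · exact Or.inl h
        · rcases h' with h' | h'
          · exact absurd ⟨h, h'⟩ hyx
          · exact Or.inr ⟨h, h'⟩
      · have h2 : Real.exp κ₁ ≤ Real.exp (t ^ j + κ₁) := by gcongr; linarith
        have h3 := mul_le_mul_of_nonneg_left h2 h0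
        have h4 := mul_le_mul_of_nonneg_left h1 hj
        linarith

theorem BoundedOn.insert {i : ℕ} {B : Set N} {x : N} (hx : Letter S i x)
    (hB : BoundedOn S (FromOr S i B)) : BoundedOn S (FromOr S i (insert x B)) := by
  intro κ
  obtain ⟨C₁, κ', hC₁, H₁⟩ := hx.powApprox κ
  obtain ⟨C₂, hC₂, H₂⟩ := hB (κ * Real.exp κ + κ')
  refine ⟨C₂ + C₁, by positivity, fun R q Q hR hq g hg => ?_⟩
  obtain ⟨k, h, rfl, hk, hh⟩ := hg.collect_letter (by positivity) hx
  obtain ⟨e, h', E, he, hq'⟩ := H₁ R q Q hR hq k hk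
  have h1 := H₂ R q Q hR hq (h * e) (hh.mul (he.imp fun _ _ h => ⟨h.1, Or.inl h.2⟩))
  rw [E, ← mul_assoc]
  linarith [hq.map_mul (h * e) h']

theorem BoundedOn.of_succ (hS : S.Finite) {i : ℕ} (h : BoundedOn S (From S (i + 1))) :
    BoundedOn S (From S i) := by
  have hfin := finite_letter hS i
  have main : ∀ B : Set N, B.Finite → B ⊆ {x | Letter S i x} → BoundedOn S (FromOr S i B) := by
    intro B hB
    induction B, hB using Set.Finite.induction_on with
    | empty =>
      intro _ κ
      obtain ⟨C, hC, H⟩ := h κ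
      refine ⟨C, hC, fun R q Q hR hq g hg => H R q Q hR hq g (hg.imp ?_)⟩
      rintro j x ⟨hx, h | h⟩
      · exact ⟨hx, h⟩
      · exact absurd h.2 (Set.notMem_empty x)
    | insert _ _ ih =>
      intro hsub
      exact (ih ((Set.subset_insert _ _).trans hsub)).insert (hsub (Set.mem_insert _ _))
  intro κ
  obtain ⟨C, hC, H⟩ := main _ hfin subset_rfl κ
  refine ⟨C, hC, fun R q Q hR hq g hg => H R q Q hR hq g (hg.imp fun j x hx => ⟨hx.1, ?_⟩)⟩
  rcases hx.2.eq_or_lt with h | h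
  · exact Or.inr ⟨h.symm, by subst h; exact hx.1⟩
  · exact Or.inl h

/-- In a nilpotent group, words of bounded cost with respect to `t = 1 / R` are bounded products of
powers of generators with exponents `O(R)`, as seen by all length functions. -/
theorem boundedOn_from [Group.IsNilpotent N] (hS : S.Finite) : BoundedOn S (From S 1) := by
  obtain ⟨k, hk⟩ := (Subgroup.nilpotent_iff_lowerCentralSeries (G := N)).1 ‹_›
  have main : ∀ n i, 2 ^ k < i + n → BoundedOn S (From S i) := by
    intro n
    induction n with
    | zero =>
      intro i hi κ
      refine ⟨0, le_rfl, fun R q Q _ hq g hg => ?_⟩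
      rw [hg.eq_one hk hi, zero_mul]
      exact hq.map_one
    | succ n ih => exact fun i hi => .of_succ hS (ih (i + 1) (by omega))
  exact main (2 ^ k) 1 (by omega)

end WeightedWord

/-! ### Entropy of a nilpotent group and of its abelianization -/

namespace WordEntropy

open WeightedWord

theorem wordLength_one {N : Type*} [Group N] (S : Set N) : wordLength S 1 = 0 :=
  SimpleGraph.dist_self

theorem wordLength_le_one {N : Type*} [Group N] {S : Set N} {s : N} (hs : s ∈ S) :
    wordLength S s ≤ 1 := by
  simpa using wordLength_le (S := S) [s] (by simpa using Or.inl hs)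

theorem wordLength_pow_le {N : Type*} [Group N] {S : Set N} (hS : Subgroup.closure S = ⊤) (g : N)
    (n : ℕ) : wordLength S (g ^ n) ≤ n * wordLength S g := by
  induction n with
  | zero => simp [wordLength_one]
  | succ n ih =>
    rw [pow_succ, add_mul, one_mul]
    exact (wordLength_mul_le hS _ _).trans (Nat.add_le_add_right ih _)

/-- The word length after applying `ψ` is a length function, bounded on powers of generators by any common
bound. -/
theorem powerBounded_wordLength {N : Type*} [Group N] {S : Set N} (hS : Subgroup.closure S = ⊤)
    (ψ : MulAut N) (R : ℕ) (Q : ℝ) (hQ : 0 ≤ Q)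
    (h : ∀ s ∈ S, ∀ k ≤ R, (wordLength S (ψ (s ^ k)) : ℝ) ≤ Q) :
    PowerBounded S (fun g => (wordLength S (ψ g) : ℝ)) R Q where
  nonneg := hQ
  map_one := by simp [wordLength_one]
  map_mul g h := by
    rw [map_mul]
    exact_mod_cast wordLength_mul_le hS _ _
  map_inv g := by
    rw [map_inv]
    exact_mod_cast wordLength_inv_le hS _
  map_pow := h

/-- If `ψ s` agrees modulo `[N, N]` with an element `u` of length at most `L`, then large powers
`ψ (s ^ k)` have length `O(k * L)`: the factor from `[N, N]` contributes, with respect to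
`t = 1 / (k * L)`, letters of weight at least `2` whose total cost tends to `0`. -/
theorem exists_wordLength_pow_le {N : Type*} [Group N] {S : Set N}
    (hS : Subgroup.closure S = ⊤) {C : ℝ}
    (hC : ∀ R : ℕ, 1 ≤ R → ∀ g, Word (From S 1) (R : ℝ)⁻¹ 1 g → (wordLength S g : ℝ) ≤ C * R)
    {L : ℕ} (hL : 1 ≤ L) {c u : N} (hu : wordLength S u ≤ L) (hc : c ∈ commutator N) :
    ∃ K : ℕ, ∀ k : ℕ, K ≤ k → (wordLength S ((c * u) ^ k) : ℝ) ≤ (1 + C) * L * k := by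
  obtain ⟨κ, hκ⟩ := Word.of_mem_commutator hS hc
  have hκ0 := hκ.nonneg zero_le_one
  refine ⟨⌈κ * Real.exp 1⌉₊ + 1, fun k hk => ?_⟩
  have hk1 : 1 ≤ k := by omega
  have hkκ : κ * Real.exp 1 ≤ k :=
    (Nat.le_ceil _).trans (by exact_mod_cast (by omega : ⌈κ * Real.exp 1⌉₊ ≤ k))
  have hk0 : (0 : ℝ) < k := by exact_mod_cast hk1
  have hL1 : (1 : ℝ) ≤ L := by exact_mod_cast hL
  have hL0 : (0 : ℝ) < L := by linarith
  set t : ℝ := ((k * L : ℕ) : ℝ)⁻¹ with ht_def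
  have ht : 0 ≤ t := by positivity
  have ht1 : t ≤ 1 := inv_le_one_of_one_le₀ (by exact_mod_cast Nat.mul_pos hk1 hL)
  have hkLt : k * (L * t) = 1 := by
    rw [ht_def]
    push_cast
    field_simp
  have hLt : (wordLength S u : ℝ) * t ≤ L * t := by
    have : (wordLength S u : ℝ) ≤ L := by exact_mod_cast hu
    gcongr
  obtain ⟨f, hf, hfe⟩ := Word.collect (G := fun j => (c * u) ^ j) (e := fun _ => c) (n := k) ht
    ((Word.of_wordLength hS u).mono hLt) (fun _ _ => hκ.rescale ht ht1) (by simp)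
    (fun j _ => by simp only [pow_succ]; group)
  have hcost : k * (κ * t ^ 2) * Real.exp (k * (L * t)) ≤ 1 := by
    have h1 : t * k ≤ 1 := by nlinarith
    calc k * (κ * t ^ 2) * Real.exp (k * (L * t)) = (κ * Real.exp 1) * (t * k) * t := by
          rw [hkLt]; ring
      _ ≤ k * 1 * t := by gcongr
      _ ≤ 1 := by linarith
  have h1 := hC (k * L) (Nat.mul_pos hk1 hL) f ((hf.mono hcost).weaken (by omega))
  have h2 : wordLength S ((c * u) ^ k) ≤ wordLength S f + k * L := by
    refine (congrArg (wordLength S) hfe).trans_le ?_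
    exact (wordLength_mul_le hS _ _).trans
      (Nat.add_le_add_left ((wordLength_pow_le hS u k).trans (Nat.mul_le_mul_left k hu)) _)
  have h3 : (wordLength S ((c * u) ^ k) : ℝ) ≤ wordLength S f + k * L := by exact_mod_cast h2
  push_cast at h1
  linarith

/-- An automorphism of a finitely generated nilpotent group stretches long elements at most by a
constant times the factor by which it stretches the generators modulo `[N, N]`; the constant does
not depend on the automorphism. -/
theorem exists_wordLength_apply_le {N : Type*} [Group N] [Group.IsNilpotent N] (S : Finset N)
    (hS : Subgroup.closure (S : Set N) = ⊤) :
    ∃ D : ℝ, 2 ≤ D ∧ ∀ (ψ : MulAut N) (L : ℕ), 1 ≤ L →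
      (∀ s ∈ S, ∃ u, wordLength (S : Set N) u ≤ L ∧ ψ s * u⁻¹ ∈ commutator N) →
      ∃ β : ℝ, 0 ≤ β ∧ ∀ g, (wordLength (S : Set N) (ψ g) : ℝ) ≤
        D * L * wordLength (S : Set N) g + β := by
  obtain ⟨C, hC0, hC⟩ := boundedOn_from S.finite_toSet 1
  refine ⟨C * (1 + C) + 2, by linarith [mul_nonneg hC0 (by linarith : 0 ≤ 1 + C)],
    fun ψ L hL hψ => ?_⟩
  have hC' : ∀ R : ℕ, 1 ≤ R → ∀ g, Word (From (S : Set N) 1) (R : ℝ)⁻¹ 1 g →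
      (wordLength (S : Set N) g : ℝ) ≤ C * R := fun R hR g hg =>
    hC R _ R hR (powerBounded_wordLength hS 1 R R (by positivity) fun s hs k hk => by
      have h1 := wordLength_pow_le hS s k
      have h2 := Nat.mul_le_mul_left k (wordLength_le_one hs)
      rw [MulAut.one_apply]
      exact_mod_cast (by omega : wordLength (S : Set N) (s ^ k) ≤ R)) g hg
  have hK : ∀ s : N, ∃ K : ℕ, s ∈ S → ∀ k : ℕ, K ≤ k →
      (wordLength (S : Set N) (ψ (s ^ k)) : ℝ) ≤ (1 + C) * L * k := by
    intro s
    by_cases hs : s ∈ S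
    · obtain ⟨u, hu, hc⟩ := hψ s hs
      obtain ⟨K, hK⟩ := exists_wordLength_pow_le hS hC' hL hu hc
      refine ⟨K, fun _ k hk => ?_⟩
      simpa using hK k hk
    · exact ⟨0, fun h => absurd h hs⟩
  choose K hK using hK
  set b : ℕ := S.sup K * maxLength S ψ with hb
  refine ⟨C * b, by positivity, fun g => ?_⟩
  set R := wordLength (S : Set N) g with hR
  have hgen : ∀ s ∈ S, ∀ k ≤ R, (wordLength (S : Set N) (ψ (s ^ k)) : ℝ) ≤
      (1 + C) * L * R + b := by
    intro s hs k hk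
    rcases le_total (K s) k with h | h
    · have h1 : (k : ℝ) ≤ R := by exact_mod_cast hk
      calc _ ≤ (1 + C) * L * k := hK s hs k h
        _ ≤ (1 + C) * L * R := by gcongr
        _ ≤ _ := by linarith [(Nat.cast_nonneg b : (0 : ℝ) ≤ b)]
    · have h1 : wordLength (S : Set N) (ψ (s ^ k)) ≤ b := by
        rw [map_pow]
        exact (wordLength_pow_le hS _ _).trans (Nat.mul_le_mul (h.trans (Finset.le_sup hs))
          (Finset.le_sup (f := fun s => wordLength (S : Set N) (ψ s)) hs))
      have h2 : (wordLength (S : Set N) (ψ (s ^ k)) : ℝ) ≤ b := by exact_mod_cast h1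
      have h3 : 0 ≤ (1 + C) * L * R := by positivity
      linarith
  rcases Nat.eq_zero_or_pos R with h0 | hpos
  · have hg : g = 1 := by
      obtain ⟨w, -, rfl, hl⟩ := exists_word hS g
      rw [← hR, h0, List.length_eq_zero_iff] at hl
      simp [hl]
    rw [hg, map_one, wordLength_one]
    push_cast
    positivity
  · have hR0 : (R : ℝ) ≠ 0 := by positivity
    have hw : Word (From (S : Set N) 1) (R : ℝ)⁻¹ 1 g :=
      (Word.of_wordLength hS g).mono (mul_inv_cancel₀ hR0).le
    have h1 := hC R _ _ hpos (powerBounded_wordLength hS ψ R _ (by positivity) hgen) g hw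
    have h2 : (0 : ℝ) ≤ 2 * L * R := by positivity
    linarith

theorem tendsto_const_rpow_inv {C : ℝ≥0∞} (h0 : C ≠ 0) (hC : C ≠ ∞) :
    Tendsto (fun n : ℕ => C ^ ((n : ℝ)⁻¹)) atTop (𝓝 1) := by
  have hpos : 0 < C.toReal := ENNReal.toReal_pos h0 hC
  have h1 := ENNReal.tendsto_ofReal ((Real.continuousAt_const_rpow (b := 0) hpos.ne').tendsto.comp
    (tendsto_inv_atTop_nhds_zero_nat (𝕜 := ℝ)))
  rw [Real.rpow_zero, ENNReal.ofReal_one] at h1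
  refine h1.congr fun n => ?_
  rw [Function.comp_apply, ← ENNReal.ofReal_rpow_of_pos hpos, ENNReal.ofReal_toReal hC]

theorem tendsto_pow_rpow_inv (c : ℝ≥0∞) :
    Tendsto (fun n : ℕ => (c ^ n) ^ ((n : ℝ)⁻¹)) atTop (𝓝 c) := by
  refine tendsto_const_nhds.congr' ?_
  filter_upwards [eventually_gt_atTop 0] with n hn
  rw [← ENNReal.rpow_natCast, ← ENNReal.rpow_mul, mul_inv_cancel₀ (by positivity),
    ENNReal.rpow_one]

/-- Sequences that are comparable up to a constant have comparable exponential growth rates. -/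
theorem growth_le_of_le_mul {a b : ℕ → ℝ≥0∞} {A B C : ℝ≥0∞} (hC : C ≠ ∞)
    (h : ∀ᶠ n in atTop, a n ≤ C * b n)
    (ha : Tendsto (fun n : ℕ => a n ^ ((n : ℝ)⁻¹)) atTop (𝓝 A))
    (hb : Tendsto (fun n : ℕ => b n ^ ((n : ℝ)⁻¹)) atTop (𝓝 B)) : A ≤ B := by
  have hC1 := tendsto_const_rpow_inv (C := max C 1) (one_pos.trans_le (le_max_right C 1)).ne'
    (by simp [hC])
  have hlim := ENNReal.Tendsto.mul hC1 (Or.inl one_ne_zero) hb (Or.inr ENNReal.one_ne_top)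
  rw [one_mul] at hlim
  refine le_of_tendsto_of_tendsto ha hlim ?_
  filter_upwards [h] with n hn
  rw [← ENNReal.mul_rpow_of_nonneg _ _ (by positivity)]
  refine ENNReal.rpow_le_rpow (hn.trans ?_) (by positivity)
  gcongr
  exact le_max_left _ _

theorem entropy_pow {G : Type*} [Group G] {S : Finset G}
    (hS : Subgroup.closure (S : Set G) = ⊤) (φ : MulAut G) {m : ℕ} (hm : 0 < m) :
    entropy S (φ ^ m) = entropy S φ ^ m := by
  refine tendsto_nhds_unique (tendsto_entropy hS (φ ^ m)).1 ?_
  have h1 := ((tendsto_entropy hS φ).1.comp (tendsto_id.const_mul_atTop' hm)).ennrpow_const m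
  rw [ENNReal.rpow_natCast] at h1
  refine h1.congr fun k => ?_
  simp only [Function.comp_apply, id]
  rw [← ENNReal.rpow_mul, pow_mul]
  congr 1
  push_cast
  field_simp

theorem eq_one_of_wordLength_eq_zero {G : Type*} [Group G] {S : Set G}
    (hS : Subgroup.closure S = ⊤) {g : G} (hg : wordLength S g = 0) : g = 1 := by
  obtain ⟨w, -, rfl, hl⟩ := exists_word hS g
  rw [hg, List.length_eq_zero_iff] at hl
  simp [hl]

theorem one_le_maxLength {G : Type*} [Group G] [Nontrivial G] {S : Finset G}
    (hS : Subgroup.closure (S : Set G) = ⊤) (ψ : MulAut G) : 1 ≤ maxLength S ψ := by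
  by_contra! h
  have h1 : ∀ s ∈ S, s = 1 := fun s hs => by
    have h2 : wordLength (S : Set G) (ψ s) ≤ maxLength S ψ :=
      Finset.le_sup (f := fun s => wordLength (S : Set G) (ψ s)) hs
    have := eq_one_of_wordLength_eq_zero hS (g := ψ s) (by omega)
    simpa using this
  have h2 : Subgroup.closure (S : Set G) ≤ ⊥ :=
    (Subgroup.closure_le _).2 fun s hs => by simpa using h1 s hs
  rw [hS, top_le_iff] at h2
  exact bot_ne_top h2

theorem inducedAut_pow_of {N : Type*} [Group N] (φ : MulAut N) (n : ℕ) (g : N) :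
    (inducedAut φ ^ n) (Abelianization.of g) = Abelianization.of ((φ ^ n) g) := by
  induction n generalizing g with
  | zero => rfl
  | succ n ih => rw [pow_succ, pow_succ, MulAut.mul_apply, MulAut.mul_apply, ← ih]; rfl

theorem wordLength_map_le {G H : Type*} [Group G] [Group H] (f : G →* H) {S : Set G}
    (hS : Subgroup.closure S = ⊤) (g : G) : wordLength (f '' S) (f g) ≤ wordLength S g := by
  obtain ⟨w, hw, rfl, hl⟩ := exists_word hS g
  rw [← hl, map_list_prod]
  refine (wordLength_le _ fun x hx => ?_).trans (by simp)
  obtain ⟨y, hy, rfl⟩ := List.mem_map.1 hx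
  rw [← map_inv]
  exact (hw y hy).imp (Set.mem_image_of_mem f) (Set.mem_image_of_mem f)

theorem exists_wordLength_le_of_image {G H : Type*} [Group G] [Group H] (f : G →* H) {S : Set G}
    (hS : Subgroup.closure (f '' S) = ⊤) (h : H) :
    ∃ g, f g = h ∧ wordLength S g ≤ wordLength (f '' S) h := by
  obtain ⟨w, hw, rfl, hl⟩ := exists_word hS h
  rw [← hl]
  have key : ∃ v : List G, (∀ x ∈ v, x ∈ S ∨ x⁻¹ ∈ S) ∧ v.map f = w := by
    clear hl
    induction w with
    | nil => exact ⟨[], by simp, rfl⟩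
    | cons a w ih =>
      obtain ⟨v, hv, rfl⟩ := ih fun x hx => hw x (by simp [hx])
      obtain ⟨b, hb, rfl⟩ : ∃ b, (b ∈ S ∨ b⁻¹ ∈ S) ∧ f b = a := by
        rcases hw a (by simp) with ⟨b, hb, h⟩ | ⟨b, hb, h⟩
        · exact ⟨b, Or.inl hb, h⟩
        · exact ⟨b⁻¹, Or.inr (by simpa using hb), by simp [h]⟩
      refine ⟨b :: v, fun x hx => ?_, rfl⟩
      rcases List.mem_cons.1 hx with rfl | hx
      exacts [hb, hv x hx]
  obtain ⟨v, hv, rfl⟩ := key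
  exact ⟨v.prod, map_list_prod f v, by simpa using wordLength_le v hv⟩

theorem closure_image_of {N : Type*} [Group N] {S : Set N} (hS : Subgroup.closure S = ⊤) :
    Subgroup.closure (Abelianization.of '' S) = ⊤ := by
  rw [← MonoidHom.map_closure, hS]
  exact Subgroup.map_top_of_surjective _ (QuotientGroup.mk'_surjective _)

theorem entropy_inducedAut_le {N : Type*} [Group N] {S : Finset N} {T : Finset (Abelianization N)}
    (hS : Subgroup.closure (S : Set N) = ⊤) (hT : (T : Set _) = Abelianization.of '' (S : Set N))
    (φ : MulAut N) : entropy T (inducedAut φ) ≤ entropy S φ := by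
  have hT' : Subgroup.closure (T : Set (Abelianization N)) = ⊤ := hT ▸ closure_image_of hS
  refine growth_le_of_le_mul ENNReal.one_ne_top (Eventually.of_forall fun n => ?_)
    (tendsto_entropy hT' (inducedAut φ)).1 (tendsto_entropy hS φ).1
  rw [one_mul, Nat.cast_le]
  refine Finset.sup_le fun a ha => ?_
  obtain ⟨s, hs, rfl⟩ : a ∈ Abelianization.of '' (S : Set N) := hT ▸ ha
  rw [inducedAut_pow_of, hT]
  exact (wordLength_map_le Abelianization.of hS _).trans
    (Finset.le_sup (f := fun s => wordLength (S : Set N) ((φ ^ n) s)) hs)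

/-- The bound on the stretching factor is iterated: the additive error does not influence the
growth rate. -/
theorem entropy_le_of_wordLength_apply_le {G : Type*} [Group G] {S : Finset G}
    (hS : Subgroup.closure (S : Set G) = ⊤) (ψ : MulAut G) {α β : ℝ} (hα : 2 ≤ α) (hβ : 0 ≤ β)
    (h : ∀ g, (wordLength (S : Set G) (ψ g) : ℝ) ≤ α * wordLength (S : Set G) g + β) :
    entropy S ψ ≤ ENNReal.ofReal α := by
  have key : ∀ s ∈ S, ∀ k : ℕ,
      (wordLength (S : Set G) ((ψ ^ k) s) : ℝ) + β ≤ (1 + β) * α ^ k := by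
    intro s hs k
    induction k with
    | zero =>
      have : (wordLength (S : Set G) s : ℝ) ≤ 1 := by
        exact_mod_cast wordLength_le_one (S := (S : Set G)) hs
      simpa using this
    | succ k ih =>
      rw [pow_succ', MulAut.mul_apply]
      have h1 := h ((ψ ^ k) s)
      have h2 := mul_le_mul_of_nonneg_left ih (by linarith : 0 ≤ α)
      have h3 := mul_le_mul_of_nonneg_right hα hβ
      rw [pow_succ]
      linarith
  refine growth_le_of_le_mul (C := ENNReal.ofReal (1 + β)) ENNReal.ofReal_ne_top
    (Eventually.of_forall fun k => ?_) (tendsto_entropy hS ψ).1 (tendsto_pow_rpow_inv _)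
  rw [← ENNReal.ofReal_pow (by linarith), ← ENNReal.ofReal_mul (by linarith),
    ← ENNReal.ofReal_natCast]
  refine ENNReal.ofReal_le_ofReal ?_
  have hbase : ∀ n : ℕ, (∀ s ∈ S, wordLength (S : Set G) ((ψ ^ k) s) ≤ n) →
      maxLength S (ψ ^ k) ≤ n := fun n hn => Finset.sup_le hn
  have h0 : 0 ≤ (1 + β) * α ^ k := by positivity
  refine le_trans ?_ (Nat.floor_le h0)
  exact_mod_cast hbase _ fun s hs => Nat.le_floor (by linarith [key s hs k])

theorem entropy_le_inducedAut {N : Type*} [Group N] [Group.IsNilpotent N]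
    [Nontrivial (Abelianization N)] {S : Finset N} {T : Finset (Abelianization N)}
    (hS : Subgroup.closure (S : Set N) = ⊤) (hT : (T : Set _) = Abelianization.of '' (S : Set N))
    (φ : MulAut N) : entropy S φ ≤ entropy T (inducedAut φ) := by
  have hT' : Subgroup.closure (T : Set (Abelianization N)) = ⊤ := hT ▸ closure_image_of hS
  obtain ⟨D, hD, H⟩ := exists_wordLength_apply_le S hS
  refine growth_le_of_le_mul (a := fun m => entropy S φ ^ m) (C := ENNReal.ofReal D)
    ENNReal.ofReal_ne_top ?_ (tendsto_pow_rpow_inv _) (tendsto_entropy hT' (inducedAut φ)).1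
  filter_upwards [eventually_gt_atTop 0] with m hm
  set L := maxLength T (inducedAut φ ^ m) with hL
  have hL1 : 1 ≤ L := one_le_maxLength hT' _
  obtain ⟨β, hβ, hψ⟩ := H (φ ^ m) L hL1 fun s hs => by
    have hsT : Abelianization.of s ∈ T := by
      rw [← Finset.mem_coe, hT]
      exact Set.mem_image_of_mem _ hs
    obtain ⟨u, hu, hul⟩ := exists_wordLength_le_of_image Abelianization.of (closure_image_of hS)
      (Abelianization.of ((φ ^ m) s))
    refine ⟨u, hul.trans ?_, ?_⟩
    · rw [← hT, ← inducedAut_pow_of]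
      exact Finset.le_sup (f := fun s => wordLength (T : Set _) ((inducedAut φ ^ m) s)) hsT
    · rw [← Abelianization.ker_of, MonoidHom.mem_ker, map_mul, map_inv, hu, mul_inv_cancel]
  have hL1' : (1 : ℝ) ≤ L := by exact_mod_cast hL1
  rw [← entropy_pow hS φ hm, ← ENNReal.ofReal_natCast L, ← ENNReal.ofReal_mul (by linarith)]
  exact entropy_le_of_wordLength_apply_le hS _ (by nlinarith) hβ hψ

end WordEntropy

/-! ### Entropy of abelian groups and the spectral radius -/

namespace WordEntropy

/-- A finitely generated abelian group is, up to a finite group, a lattice: it has coordinates with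
values in `ℤ` such that each element is determined by its coordinates up to finitely many
elements. -/
theorem exists_lattice_coordinates (A : Type*) [AddCommGroup A] [AddGroup.FG A] :
    ∃ (n : ℕ) (π : Fin n → A →+ ℤ) (e : Fin n → A) (F : Set A), F.Finite ∧
      (∀ a, a - ∑ i, π i a • e i ∈ F) ∧ (∀ i, π i (e i) = 1) ∧
      (∀ a, (∀ i, π i a = 0) → IsOfFinAddOrder a) ∧ (Infinite A → 0 < n) := by
  obtain ⟨n, ι, _, p, hp, k, ⟨E⟩⟩ := AddCommGroup.equiv_free_prod_directSum_zmod A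
  classical
  have hfin : Finite (DirectSum ι fun i => ZMod (p i ^ k i)) := by
    have : ∀ i, NeZero (p i ^ k i) := fun i => ⟨pow_ne_zero _ (hp i).ne_zero⟩
    exact Finite.of_injective _ (DirectSum.addEquivProd fun i => ZMod (p i ^ k i)).injective
  set π : Fin n → A →+ ℤ := fun i =>
    (Finsupp.applyAddHom i).comp ((AddMonoidHom.fst _ _).comp E.toAddMonoidHom) with hπ
  have hπa : ∀ i a, π i a = (E a).1 i := fun _ _ => rfl
  have hker : ∀ a, (∀ i, π i a = 0) → (E a).1 = 0 := fun a ha => Finsupp.ext fun i => ha i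
  have hfinord : ∀ a, (∀ i, π i a = 0) → IsOfFinAddOrder a := by
    intro a ha
    have h1 := isOfFinAddOrder_of_finite (E a).2
    rw [isOfFinAddOrder_iff_nsmul_eq_zero] at h1 ⊢
    obtain ⟨m, hm, h⟩ := h1
    refine ⟨m, hm, E.injective ?_⟩
    rw [map_nsmul, map_zero]
    exact Prod.ext (by simp [hker a ha]) h
  refine ⟨n, π, fun i => E.symm (Finsupp.single i 1, 0), {a | ∀ i, π i a = 0}, ?_, ?_, ?_,
    hfinord, ?_⟩
  · refine Set.Finite.of_finite_image (f := fun a => (E a).2) (Set.toFinite _) ?_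
    intro a ha b hb hab
    exact E.injective (Prod.ext ((hker a ha).trans (hker b hb).symm) hab)
  · intro a j
    rw [map_sub, map_sum, sub_eq_zero]
    simp only [map_zsmul]
    simp [hπa, Finsupp.single_apply]
  · intro i
    simp [hπa]
  · intro hA
    by_contra! h0
    obtain rfl : n = 0 := by omega
    have : Finite A := Finite.of_injective (fun a => (E a).2) fun a b hab =>
      E.injective (Prod.ext (Subsingleton.elim _ _) hab)
    exact not_finite A

/-- A subadditive and symmetric function grows at most linearly with the word length. -/
theorem exists_le_mul_wordLength {G : Type*} [Group G] (S : Finset G)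
    (hS : Subgroup.closure (S : Set G) = ⊤) (q : G → ℝ) (h1 : q 1 = 0)
    (hmul : ∀ g h, q (g * h) ≤ q g + q h) (hinv : ∀ g, q g⁻¹ = q g) :
    ∃ C : ℝ, 0 ≤ C ∧ ∀ g, q g ≤ C * wordLength (S : Set G) g := by
  have hb : ∀ s ∈ S, q s ≤ ∑ s ∈ S, |q s| := fun s hs => (le_abs_self _).trans
    (Finset.single_le_sum (f := fun s => |q s|) (fun _ _ => abs_nonneg _) hs)
  refine ⟨∑ s ∈ S, |q s|, Finset.sum_nonneg fun _ _ => abs_nonneg _, fun g => ?_⟩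
  obtain ⟨w, hw, rfl, hl⟩ := exists_word hS g
  rw [← hl]
  clear hl
  induction w with
  | nil => simp [h1]
  | cons a w ih =>
    have ha : q a ≤ ∑ s ∈ S, |q s| := by
      rcases hw a (by simp) with h | h
      · exact hb a (by simpa using h)
      · rw [← hinv]
        exact hb _ (by simpa using h)
    have := ih fun x hx => hw x (by simp [hx])
    rw [List.prod_cons, List.length_cons]
    push_cast
    linarith [hmul a w.prod]

section Abelian

variable {A : Type*} [CommGroup A]

/-- The action of an automorphism of the abelian group `A` on `ℂ ⊗ A`. -/
noncomputable def tensorEnd (ψ : MulAut A) : Module.End ℂ (ℂ ⊗[ℤ] Additive A) :=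
  LinearMap.baseChange ℂ (MonoidHom.toAdditive ψ.toMonoidHom).toIntLinearMap

theorem tensorEnd_pow_tmul (ψ : MulAut A) (n : ℕ) (z : ℂ) (a : A) :
    (tensorEnd ψ ^ n) (z ⊗ₜ[ℤ] Additive.ofMul a) = z ⊗ₜ[ℤ] Additive.ofMul ((ψ ^ n) a) := by
  induction n generalizing a with
  | zero => rfl
  | succ n ih =>
    rw [pow_succ, pow_succ, Module.End.mul_apply, MulAut.mul_apply, ← ih]
    rfl

theorem wordLength_zpow_le {T : Set A} (hT : Subgroup.closure T = ⊤) (a : A) (n : ℤ) :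
    wordLength T (a ^ n) ≤ n.natAbs * wordLength T a := by
  rcases n.natAbs_eq with h | h <;> rw [h]
  · rw [zpow_natCast, Int.natAbs_natCast]
    exact wordLength_pow_le hT a _
  · rw [zpow_neg, zpow_natCast, Int.natAbs_neg, Int.natAbs_natCast]
    exact (wordLength_inv_le hT _).trans (wordLength_pow_le hT a _)

theorem wordLength_prod_le {T : Set A} (hT : Subgroup.closure T = ⊤) {ι : Type*} (s : Finset ι)
    (f : ι → A) : wordLength T (∏ i ∈ s, f i) ≤ ∑ i ∈ s, wordLength T (f i) := by
  classical
  induction s using Finset.induction_on with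
  | empty => simp [wordLength_one]
  | insert i s hi ih =>
    rw [Finset.prod_insert hi, Finset.sum_insert hi]
    exact (wordLength_mul_le hT _ _).trans (Nat.add_le_add_left ih _)

/-- The `ℂ`-linear extension of an integral functional. -/
noncomputable def extendFunctional (π : Additive A →+ ℤ) : ℂ ⊗[ℤ] Additive A →ₗ[ℂ] ℂ :=
  (TensorProduct.AlgebraTensorModule.rid ℤ ℂ ℂ).toLinearMap ∘ₗ
    LinearMap.baseChange ℂ π.toIntLinearMap

theorem extendFunctional_tmul (π : Additive A →+ ℤ) (a : Additive A) :
    extendFunctional π (1 ⊗ₜ[ℤ] a) = π a := by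
  simp [extendFunctional]

attribute [local instance] Matrix.linftyOpNormedRing Matrix.linftyOpNormedAlgebra

theorem exists_matrix_norm_le {d : Type*} [Fintype d] [DecidableEq d] {M : ℕ → Matrix d d ℂ}
    {L : ℕ → ℝ} (h : ∀ w : d → ℂ, ∃ C : ℝ, ∀ n, ‖(M n).mulVec w‖ ≤ C * L n) :
    ∃ C : ℝ, ∀ n, ‖M n‖ ≤ C * L n := by
  choose C hC using fun j => h (Pi.single j 1)
  refine ⟨∑ j, C j, fun n => ?_⟩
  have h1 : ∀ i j, ‖M n i j‖ ≤ C j * L n := fun i j => by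
    refine le_trans ?_ (hC j n)
    simpa using norm_le_pi_norm ((M n).mulVec (Pi.single j 1)) i
  have h2 : 0 ≤ ∑ j, C j * L n :=
    Finset.sum_nonneg fun j _ => (norm_nonneg (M n j j)).trans (h1 j j)
  rw [Finset.sum_mul]
  have h3 : ‖M n‖₊ ≤ Real.toNNReal (∑ j, C j * L n) := by
    rw [Matrix.linfty_opNNNorm_def]
    refine Finset.sup_le fun i _ => ?_
    rw [← NNReal.coe_le_coe, Real.coe_toNNReal _ h2]
    push_cast
    exact Finset.sum_le_sum fun j _ => h1 i j
  have h4 := NNReal.coe_le_coe.2 h3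
  rwa [Real.coe_toNNReal _ h2] at h4

/-- On an infinite finitely generated abelian group the largest length of the image of a generator
is comparable to the norm of the induced endomorphism of `ℂ ⊗ A`, written as a matrix. -/
theorem exists_matrix_comparison [Infinite A] {T : Finset A}
    (hT : Subgroup.closure (T : Set A) = ⊤) (ψ : MulAut A) :
    ∃ (d : ℕ) (M : Matrix (Fin d) (Fin d) ℂ) (C C' : ℝ),
      spectralRadius ℂ M = spectralRadius ℂ (tensorEnd ψ) ∧
      (∀ n, ‖M ^ n‖ ≤ C * maxLength T (ψ ^ n)) ∧
      (∀ n, (maxLength T (ψ ^ n) : ℝ) ≤ C' * ‖M ^ n‖) := by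
  have hfg : Group.FG A := ⟨⟨T, hT⟩⟩
  have hfg' : AddGroup.FG (Additive A) := inferInstance
  have hfin : Module.Finite ℤ (Additive A) := Module.Finite.iff_addGroup_fg.2 hfg'
  set b := Module.finBasis ℂ (ℂ ⊗[ℤ] Additive A) with hb
  set f := tensorEnd ψ with hf
  set M := LinearMap.toMatrixAlgEquiv b f with hM
  set v : A → (Fin _ → ℂ) := fun a => b.equivFun (1 ⊗ₜ[ℤ] Additive.ofMul a) with hv
  have hMn : ∀ n x, (M ^ n).mulVec (b.equivFun x) = b.equivFun ((f ^ n) x) := by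
    intro n x
    rw [hM, ← map_pow]
    exact LinearMap.toMatrix_mulVec_repr b b (f ^ n) x
  have hMv : ∀ n a, (M ^ n).mulVec (v a) = v ((ψ ^ n) a) := by
    intro n a
    rw [hMn, hf, tensorEnd_pow_tmul]
  have hvmul : ∀ g h, v (g * h) = v g + v h := fun g h => by
    rw [hv, ← map_add, ← TensorProduct.tmul_add]; rfl
  have hvinv : ∀ g, v g⁻¹ = - v g := fun g => by
    rw [hv, ← map_neg, ← TensorProduct.tmul_neg]; rfl
  have hvone : v 1 = 0 := by
    have := hvmul 1 1
    rw [mul_one] at this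
    simpa using this
  obtain ⟨C₀, hC₀, hv₀⟩ := exists_le_mul_wordLength T hT (fun g => ‖v g‖) (by simp [hvone])
    (fun g h => by rw [hvmul]; exact norm_add_le _ _) (fun g => by rw [hvinv, norm_neg])
  -- The norm is bounded by the length: it suffices to consider pure tensors.
  have hlow : ∃ C : ℝ, ∀ n, ‖M ^ n‖ ≤ C * maxLength T (ψ ^ n) := by
    refine exists_matrix_norm_le fun w => ?_
    obtain ⟨x, rfl⟩ := b.equivFun.surjective w
    simp only [hMn]
    induction x using TensorProduct.induction_on with
    | zero => exact ⟨0, fun n => by simp⟩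
    | tmul z a =>
      refine ⟨‖z‖ * (C₀ * wordLength (T : Set A) a.toMul), fun n => ?_⟩
      have h1 : b.equivFun ((f ^ n) (z ⊗ₜ[ℤ] a)) = z • v ((ψ ^ n) a.toMul) := by
        rw [hv, ← map_smul, TensorProduct.smul_tmul', smul_eq_mul, mul_one]
        exact congrArg _ (tensorEnd_pow_tmul ψ n z a.toMul)
      have h2 : (wordLength (T : Set A) ((ψ ^ n) a.toMul) : ℝ) ≤
          wordLength (T : Set A) a.toMul * maxLength T (ψ ^ n) := by
        exact_mod_cast wordLength_apply_le hT (ψ ^ n) a.toMul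
      rw [h1, norm_smul]
      calc ‖z‖ * ‖v ((ψ ^ n) a.toMul)‖
          ≤ ‖z‖ * (C₀ * (wordLength (T : Set A) a.toMul * maxLength T (ψ ^ n))) := by
            gcongr
            exact (hv₀ _).trans (by gcongr)
        _ = _ := by ring
    | add x y hx hy =>
      obtain ⟨C, hC⟩ := hx
      obtain ⟨C', hC'⟩ := hy
      refine ⟨C + C', fun n => ?_⟩
      rw [map_add, map_add, add_mul]
      exact (norm_add_le _ _).trans (add_le_add (hC n) (hC' n))
  obtain ⟨C, hC⟩ := hlow
  -- The length is bounded by the norm: the integral coordinates extend to `ℂ ⊗ A`.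
  obtain ⟨r, π, e, F, hF, hdec, hπe, hord, hr⟩ := exists_lattice_coordinates (Additive A)
  have hπ : ∀ i, ∃ K : ℝ, 0 ≤ K ∧ ∀ a : A, |(π i (Additive.ofMul a) : ℝ)| ≤ K * ‖v a‖ := by
    intro i
    set Λ := LinearMap.toContinuousLinearMap
      (extendFunctional (π i) ∘ₗ b.equivFun.symm.toLinearMap) with hΛ
    refine ⟨‖Λ‖, norm_nonneg _, fun a => ?_⟩
    have h1 : Λ (v a) = (π i (Additive.ofMul a) : ℂ) := by
      rw [← extendFunctional_tmul]
      simp [hΛ, hv]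
    have h2 := Λ.le_opNorm (v a)
    rw [h1] at h2
    simpa using h2
  choose K hK0 hK using hπ
  obtain ⟨B, hB⟩ : ∃ B : ℕ, ∀ a ∈ F, wordLength (T : Set A) a.toMul ≤ B := by
    obtain ⟨B, hB⟩ := (hF.image fun a => wordLength (T : Set A) a.toMul).bddAbove
    exact ⟨B, fun a ha => hB (Set.mem_image_of_mem _ ha)⟩
  set C₁ := ∑ i, K i * wordLength (T : Set A) (e i).toMul with hC₁
  have hC₁0 : 0 ≤ C₁ := Finset.sum_nonneg fun i _ => mul_nonneg (hK0 i) (Nat.cast_nonneg _)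
  have hup : ∀ a : A, (wordLength (T : Set A) a : ℝ) ≤ C₁ * ‖v a‖ + B := by
    intro a
    have h1 : a = (Additive.ofMul a - ∑ i, π i (Additive.ofMul a) • e i).toMul *
        ∏ i, (e i).toMul ^ π i (Additive.ofMul a) := by
      apply Additive.ofMul.injective
      rw [ofMul_mul, ofMul_prod]
      simp
    have h2 : wordLength (T : Set A) a ≤
        B + ∑ i, (π i (Additive.ofMul a)).natAbs * wordLength (T : Set A) (e i).toMul := by
      conv_lhs => rw [h1]
      exact (wordLength_mul_le hT _ _).trans (add_le_add (hB _ (hdec _))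
        ((wordLength_prod_le hT _ _).trans
          (Finset.sum_le_sum fun i _ => wordLength_zpow_le hT _ _)))
    have h3 : (wordLength (T : Set A) a : ℝ) ≤ B + ∑ i, |(π i (Additive.ofMul a) : ℝ)| *
        wordLength (T : Set A) (e i).toMul := by
      have h4 : (wordLength (T : Set A) a : ℝ) ≤ ((B + ∑ i, (π i (Additive.ofMul a)).natAbs *
        wordLength (T : Set A) (e i).toMul : ℕ) : ℝ) := by exact_mod_cast h2
      push_cast [Nat.cast_natAbs] at h4
      exact h4
    rw [hC₁, Finset.sum_mul]
    refine h3.trans ?_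
    rw [add_comm]
    refine add_le_add_left (Finset.sum_le_sum fun i _ => ?_) _
    calc _ ≤ (K i * ‖v a‖) * wordLength (T : Set A) (e i).toMul := by
          gcongr
          exact hK i a
      _ = _ := by ring
  -- An element of infinite order keeps the norms away from zero.
  obtain ⟨c, hc0, hc⟩ : ∃ c : ℝ, 0 ≤ c ∧ ∀ n, 1 ≤ c * ‖M ^ n‖ := by
    set x : Additive A := e ⟨0, hr inferInstance⟩ with hx
    refine ⟨(∑ i, K i) * ‖v x.toMul‖,
      mul_nonneg (Finset.sum_nonneg fun i _ => hK0 i) (norm_nonneg _), fun n => ?_⟩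
    obtain ⟨i, hi⟩ : ∃ i, π i (Additive.ofMul ((ψ ^ n) x.toMul)) ≠ 0 := by
      by_contra! h
      obtain ⟨m, hm, h1⟩ := isOfFinAddOrder_iff_nsmul_eq_zero.1 (hord _ h)
      have h2 : ((ψ ^ n) x.toMul) ^ m = 1 := h1
      rw [← map_pow, EmbeddingLike.map_eq_one_iff] at h2
      have h3 : m • x = 0 := h2
      have h4 := congrArg (π ⟨0, hr inferInstance⟩) h3
      rw [map_nsmul, hx, hπe, map_zero] at h4
      simp at h4
      omega
    have h1 : (1 : ℝ) ≤ |(π i (Additive.ofMul ((ψ ^ n) x.toMul)) : ℝ)| := by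
      exact_mod_cast Int.one_le_abs hi
    calc (1 : ℝ) ≤ K i * ‖v ((ψ ^ n) x.toMul)‖ := h1.trans (hK i _)
      _ ≤ (∑ i, K i) * (‖M ^ n‖ * ‖v x.toMul‖) := by
          have h2 := Finset.single_le_sum (f := K) (fun i _ => hK0 i) (Finset.mem_univ i)
          rw [← hMv]
          have h3 := Matrix.linfty_opNorm_mulVec (M ^ n) (v x.toMul)
          have h4 := Finset.sum_nonneg fun i (_ : i ∈ Finset.univ) => hK0 i
          gcongr
      _ = _ := by ring
  refine ⟨_, M, C, C₁ * (∑ s ∈ T, ‖v s‖) + B * c, ?_, hC, fun n => ?_⟩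
  · unfold spectralRadius
    rw [hM, AlgEquiv.spectrum_eq]
  · obtain ⟨s, hs, hmax⟩ : ∃ s ∈ T, maxLength T (ψ ^ n) = wordLength (T : Set A) ((ψ ^ n) s) := by
      refine Finset.exists_mem_eq_sup T ?_ _
      by_contra h
      rw [Finset.not_nonempty_iff_eq_empty] at h
      rw [h, Finset.coe_empty, Subgroup.closure_empty] at hT
      exact bot_ne_top hT
    rw [hmax]
    have h1 := hup ((ψ ^ n) s)
    have h2 : ‖v ((ψ ^ n) s)‖ ≤ ‖M ^ n‖ * ∑ s ∈ T, ‖v s‖ := by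
      rw [← hMv]
      refine (Matrix.linfty_opNorm_mulVec (M ^ n) (v s)).trans ?_
      gcongr
      exact Finset.single_le_sum (f := fun s => ‖v s‖) (fun _ _ => norm_nonneg _) hs
    have h3 := mul_le_mul_of_nonneg_left h2 hC₁0
    have h4 := mul_le_mul_of_nonneg_left (hc n) (Nat.cast_nonneg (α := ℝ) B)
    linarith

theorem entropy_eq_spectralRadius [Infinite A] {T : Finset A}
    (hT : Subgroup.closure (T : Set A) = ⊤) (ψ : MulAut A) :
    entropy T ψ = spectralRadius ℂ (tensorEnd ψ) := by
  obtain ⟨d, M, C, C', hM, h1, h2⟩ := exists_matrix_comparison hT ψ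
  have hcomp : CompleteSpace (Matrix (Fin d) (Fin d) ℂ) := FiniteDimensional.complete ℂ _
  have hlim := spectrum.pow_nnnorm_pow_one_div_tendsto_nhds_spectralRadius M
  simp only [one_div] at hlim
  rw [← hM]
  have hnorm : ∀ n, (‖M ^ n‖₊ : ℝ≥0∞) = ENNReal.ofReal ‖M ^ n‖ := fun n =>
    (ofReal_norm (M ^ n)).symm
  refine le_antisymm
    (growth_le_of_le_mul (C := ENNReal.ofReal |C'|) ENNReal.ofReal_ne_top
      (Eventually.of_forall fun n => ?_) (tendsto_entropy hT ψ).1 hlim)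
    (growth_le_of_le_mul (C := ENNReal.ofReal |C|) ENNReal.ofReal_ne_top
      (Eventually.of_forall fun n => ?_) hlim (tendsto_entropy hT ψ).1)
  · rw [hnorm, ← ENNReal.ofReal_mul (abs_nonneg _), ← ENNReal.ofReal_natCast]
    refine ENNReal.ofReal_le_ofReal ((h2 n).trans ?_)
    gcongr
    exact le_abs_self _
  · rw [hnorm, ← ENNReal.ofReal_natCast, ← ENNReal.ofReal_mul (abs_nonneg _)]
    refine ENNReal.ofReal_le_ofReal ((h1 n).trans ?_)
    gcongr
    exact le_abs_self _

end Abelian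

/-! ### Nilpotent groups with finite abelianization -/

open scoped commutatorElement in
/-- Each quotient of consecutive terms of the lower central series is generated by commutators
`⁅x, y⁆` that are multiplicative in `x`, so its exponent divides the one of the abelianization. -/
theorem pow_mem_lowerCentralSeries_succ {N : Type*} [Group N] {e : ℕ}
    (he : ∀ g : N, g ^ e ∈ commutator N) (i : ℕ) {g : N}
    (hg : g ∈ (⊤ : Subgroup N).lowerCentralSeries i) :
    g ^ e ∈ (⊤ : Subgroup N).lowerCentralSeries (i + 1) := by
  induction i generalizing g with
  | zero => rw [zero_add, Subgroup.top_lowerCentralSeries_one]; exact he g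
  | succ i ih =>
    set Q := (⊤ : Subgroup N).lowerCentralSeries (i + 1 + 1) with hQ
    have hone : ∀ x, (QuotientGroup.mk' Q) x = 1 ↔ x ∈ Q := QuotientGroup.eq_one_iff
    have hcomm : ∀ x ∈ (⊤ : Subgroup N).lowerCentralSeries (i + 1), ∀ y,
        Commute (QuotientGroup.mk' Q x) (QuotientGroup.mk' Q y) := fun x hx y => by
      rw [← commutatorElement_eq_one_iff_commute, ← map_commutatorElement, hone]
      exact Subgroup.commutator_mem_commutator hx (Subgroup.mem_top y)
    have hpow : ∀ x ∈ (⊤ : Subgroup N).lowerCentralSeries i, ∀ y, ∀ k : ℕ,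
        QuotientGroup.mk' Q ⁅x ^ k, y⁆ = QuotientGroup.mk' Q ⁅x, y⁆ ^ k := by
      intro x hx y k
      induction k with
      | zero => rw [pow_zero, pow_zero, commutatorElement_one_left, map_one]
      | succ k ihk =>
        have h := hcomm ⁅x, y⁆ (Subgroup.commutator_mem_commutator hx (Subgroup.mem_top y)) (x ^ k)
        rw [pow_succ x, commutatorElement_mul_left_eq_conj_mul, map_mul, ihk, map_mul, map_mul,
          map_inv, ← h.eq, mul_inv_cancel_right, pow_succ']
    rw [← hone, map_pow]
    replace hg : g ∈ Subgroup.closure {x | ∃ a ∈ (⊤ : Subgroup N).lowerCentralSeries i,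
      ∃ b ∈ (⊤ : Subgroup N), ⁅a, b⁆ = x} := hg
    induction hg using Subgroup.closure_induction with
    | mem x hx =>
      obtain ⟨a, ha, b, -, rfl⟩ := hx
      rw [← hpow a ha b e, hone]
      exact Subgroup.commutator_mem_commutator (ih ha) (Subgroup.mem_top b)
    | one => rw [map_one, one_pow]
    | mul x y hx _ ihx ihy => rw [map_mul, (hcomm x hx y).mul_pow, ihx, ihy, one_mul]
    | inv x _ ihx => rw [map_inv, inv_pow, ihx, inv_one]

theorem subsingleton_of_finite_abelianization {N : Type*} [Group N] [Group.IsNilpotent N]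
    (htf : ∀ g : N, IsOfFinOrder g → g = 1) [Finite (Abelianization N)] : Subsingleton N := by
  set e := Nat.card (Abelianization N) with he_def
  have he0 : 0 < e := Nat.card_pos
  have he : ∀ g : N, g ^ e ∈ commutator N := fun g => by
    rw [← Abelianization.ker_of, MonoidHom.mem_ker, map_pow]
    exact pow_card_eq_one'
  obtain ⟨k, hk⟩ := (Subgroup.nilpotent_iff_lowerCentralSeries (G := N)).1 ‹_›
  have main : ∀ n, n ≤ k → (⊤ : Subgroup N).lowerCentralSeries (k - n) = ⊥ := by
    intro n
    induction n with
    | zero => exact fun _ => hk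
    | succ n ih =>
      intro hn
      rw [eq_bot_iff]
      intro g hg
      have h1 := pow_mem_lowerCentralSeries_succ he _ hg
      rw [show k - (n + 1) + 1 = k - n by omega, ih (by omega), Subgroup.mem_bot] at h1
      exact htf g (isOfFinOrder_iff_pow_eq_one.2 ⟨e, he0, h1⟩)
  have h := main k le_rfl
  rw [Nat.sub_self, Subgroup.lowerCentralSeries_zero] at h
  exact Subgroup.subsingleton_iff.1 (subsingleton_of_bot_eq_top h.symm)

theorem entropy_of_subsingleton {G : Type*} [Group G] [Subsingleton G] (S : Finset G)
    (φ : MulAut G) : entropy S φ = 0 := by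
  refine le_antisymm (Finset.sup_le fun s _ => ?_) bot_le
  have h : growthRate (S : Set G) φ s = 0 := by
    refine Tendsto.limsup_eq (tendsto_const_nhds.congr' ?_)
    filter_upwards [eventually_gt_atTop 0] with n hn
    rw [Subsingleton.elim ((φ ^ n) s) 1, wordLength_one]
    simp [hn]
  exact h.le

end WordEntropy

theorem theorem1p2 {N : Type*} [Group N] [Group.IsNilpotent N]
    (htf : ∀ g : N, IsOfFinOrder g → g = 1) (φ : MulAut N)
    (S : Finset N) (hS : Subgroup.closure (S : Set N) = ⊤)
    (T : Finset (Abelianization N)) (hT : Subgroup.closure (T : Set (Abelianization N)) = ⊤) :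
    WordEntropy.entropy S φ = WordEntropy.entropy T (WordEntropy.inducedAut φ) ∧
      WordEntropy.entropy S φ = spectralRadius ℂ (WordEntropy.homologyMap φ) := by
  classical
  rcases finite_or_infinite (Abelianization N) with hfin | hinf
  · have hN := WordEntropy.subsingleton_of_finite_abelianization htf
    have hA : Subsingleton (Abelianization N) :=
      (QuotientGroup.mk'_surjective (commutator N)).subsingleton
    have hV : Subsingleton (ℂ ⊗[ℤ] Additive (Abelianization N)) :=
      inferInstance
    rw [WordEntropy.entropy_of_subsingleton, WordEntropy.entropy_of_subsingleton,
      spectrum.SpectralRadius.of_subsingleton]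
    exact ⟨rfl, rfl⟩
  · have hT' : ((S.image Abelianization.of : Finset (Abelianization N)) : Set _) =
        Abelianization.of '' (S : Set N) := Finset.coe_image
    have h1 := (WordEntropy.entropy_le_inducedAut hS hT' φ).antisymm
      (WordEntropy.entropy_inducedAut_le hS hT' φ)
    rw [WordEntropy.entropy_eq_spectralRadius (hT' ▸ WordEntropy.closure_image_of hS)] at h1
    exact ⟨h1.trans (WordEntropy.entropy_eq_spectralRadius hT _).symm, h1⟩
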